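/- For a smooth closed immersed plane curve $\gamma$ with arclength parameter $s$ and unit tangent $\tau$, let $\nu$ be $\tau$ rotated by $+\pi/2$, let $k$ be the curvature scalar ($\tau_s=k\nu$), $L=\int ds$ the length, $\omega=\frac1{2\pi}\int k\,ds$ the turning number, $\bar k=\frac1L\int k\,ds$, and $$K_{\mathrm{osc}}=L\int (k-\bar k)^2\,ds,\qquad e=\int (k-1)^2\,ds .$$ The rescaled free elastic flow is $$\partial_t\gamma=-\big(2k_{ss}+k^3-\lambda(t)\,(\gamma\cdot\nu)\big)\nu,\qquad \lambda(t)=\frac1{L(t)}\Big(2\int k_s^2\,ds-\int k^4\,ds\Big).$$ There exist universal constants $\varepsilon_0>0$ and $C>0$ (in particular independent of $\omega$) such that the following holds. Let $\omega\ge 1$ be an integer, let $0<T\le\infty$, and let $\gamma(\cdot,t)$, $t\in[0,T)$, be a smooth solution of the rescaled free elastic flow (smooth up to $t=0$) by closed immersed plane curves, whose initial curve has turning number $\omega$ and length $2\pi\omega$. If $e(0)\le\varepsilon_0$, then $e$ is differentiable on $[0,T)$ (one-sidedly at $t=0$) and for all $t\in[0,T)$ $$e'(t)\le-\tfrac74\,e(t)+C\,e(t)^2,\qquad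 e(t)\le 2\,e(0)\,\mathrm e^{-\frac74 t},$$ and moreover $$K_{\mathrm{osc}}(t)\le K_{\mathrm{osc}}(0),\qquad K_{\mathrm{osc}}(t)\le 2\,K_{\mathrm{osc}}(0)\,\mathrm e^{-\frac74 t}.$$ In particular, for $T=\infty$ these hold for all $t\ge0$. -/

import Mathlib

noncomputable section

/-! The Euclidean plane is identified with `ℂ`, with real inner product `inner ℝ z w`.
A closed plane curve is a `2π`-periodic map `c : ℝ → ℂ`. -/

namespace ElasticFlow

/-- The speed `|c'(u)|`, so that the arclength element is `ds = |c'(u)| du`. -/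
def speed (c : ℝ → ℂ) (u : ℝ) : ℝ := ‖deriv c u‖

/-- The arclength derivative `f_s = |c'|⁻¹ f'` of a function `f` along the curve `c`. -/
def arcDeriv {E : Type*} [NormedAddCommGroup E] [NormedSpace ℝ E]
    (c : ℝ → ℂ) (f : ℝ → E) (u : ℝ) : E := (speed c u)⁻¹ • deriv f u

/-- The unit tangent `τ = c_s`. -/
def tangent (c : ℝ → ℂ) : ℝ → ℂ := arcDeriv c c

/-- The unit normal `ν`, the tangent rotated by `+π/2`; thus `τ_s = k ν` and `ν_s = - k τ`. -/
def normal (c : ℝ → ℂ) (u : ℝ) : ℂ := Complex.I * tangent c u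

/-- The curvature scalar `k = ⟨c_ss, ν⟩`. -/
def curvature (c : ℝ → ℂ) (u : ℝ) : ℝ := inner ℝ (arcDeriv c (tangent c) u) (normal c u)

/-- The first arclength derivative `k_s` of the curvature. -/
def curvatureS (c : ℝ → ℂ) : ℝ → ℝ := arcDeriv c (curvature c)

/-- The second arclength derivative `k_ss` of the curvature. -/
def curvatureSS (c : ℝ → ℂ) : ℝ → ℝ := arcDeriv c (curvatureS c)

/-- The integral `∫ f ds` over one period of the closed curve `c`. -/
def arcIntegral (c : ℝ → ℂ) (f : ℝ → ℝ) : ℝ :=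
  ∫ u in (0 : ℝ)..(2 * Real.pi), f u * speed c u

/-- The length `L = ∫ ds`. -/
def length (c : ℝ → ℂ) : ℝ := arcIntegral c (fun _ => 1)

/-- The turning number `(2π)⁻¹ ∫ k ds`. -/
def turningNumber (c : ℝ → ℂ) : ℝ := (2 * Real.pi)⁻¹ * arcIntegral c (curvature c)

/-- The mean curvature integral `L⁻¹ ∫ k ds`. -/
def meanCurvature (c : ℝ → ℂ) : ℝ := (length c)⁻¹ * arcIntegral c (curvature c)

/-- The normalised oscillation of curvature, `L ∫ (k - L⁻¹ ∫ k ds)² ds`. -/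
def kOsc (c : ℝ → ℂ) : ℝ :=
  length c * arcIntegral c (fun u => (curvature c u - meanCurvature c) ^ 2)

/-- The quantity `e = ∫ (k - 1)² ds`. -/
def curvatureExcess (c : ℝ → ℂ) : ℝ := arcIntegral c (fun u => (curvature c u - 1) ^ 2)

/-- The rescaling factor `λ = L⁻¹ (2 ∫ k_s² ds - ∫ k⁴ ds)`. -/
def rescalingFactor (c : ℝ → ℂ) : ℝ :=
  (length c)⁻¹ * (2 * arcIntegral c (fun u => curvatureS c u ^ 2)
    - arcIntegral c (fun u => curvature c u ^ 4))

/-- The time interval `[0, T)`, where `T = ⊤` gives `[0, ∞)`. -/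
def timeInterval (T : EReal) : Set ℝ := {t | 0 ≤ t ∧ (t : EReal) < T}

open scoped ContDiff in
/-- `γ t u` is a smooth solution on the time interval `[0, T)` of the (length preserving)
rescaled free elastic flow `∂ₜγ = -(2 k_ss + k³ - λ ⟨γ, ν⟩) ν` of smooth closed immersed plane
curves. At `t = 0` the time derivative is one-sided. -/
structure IsRescaledFreeElasticFlow (T : EReal) (γ : ℝ → ℝ → ℂ) : Prop where
  smooth : ContDiffOn ℝ ∞ (fun p : ℝ × ℝ => γ p.1 p.2) (timeInterval T ×ˢ Set.univ)
  closed : ∀ t ∈ timeInterval T, Function.Periodic (γ t) (2 * Real.pi)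
  immersed : ∀ t ∈ timeInterval T, ∀ u, deriv (γ t) u ≠ 0
  evolution : ∀ t ∈ timeInterval T, ∀ u,
    derivWithin (fun τ => γ τ u) (timeInterval T) t =
      (-(2 * curvatureSS (γ t) u + curvature (γ t) u ^ 3
        - rescalingFactor (γ t) * inner ℝ (γ t u) (normal (γ t) u))) • normal (γ t) u

end ElasticFlow

end

/-! Along the flow the length and the total curvature are constant, so `∫ k ds = L = 2πω` for all
times, `k̄ = 1`, and `K_osc = 2πω e`. Everything therefore reduces to a differential inequality for
`e = ∫ f² ds` with `f = k - 1`, where `∫ f ds = 0`. The first variation formulas give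
`e' = -∫ (2 k_ss + k³)² ds - λ ∫ k² ds` (`IsRescaledFreeElasticFlow.hasDerivWithinAt`); the term
with `λ` comes from the scaling identity `∫ (2 k_ss + k³) ⟨γ, ν⟩ ds = -∫ k² ds`.

Expanding in `f`, the quadratic part of `e'` is
`-4 ∫ f_ss² + 10 ∫ f_s² - 8 ∫ f² = -4 ∫ h² - 7/4 ∫ f²` with `h = f_ss + 5/4 f`, which is where the
rate `7/4` comes from. There is no spare multiple of `e` to absorb cubic terms, and the error has
to be `e²` rather than `e^(3/2)`. The point is that the cubic part `24 ∫ f f_s² - 16 ∫ f³`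
vanishes when `h = 0`: integrations by parts turn it into `-64/5 ∫ f² h - 32/25 ∫ h f_s²`
(`IsClosedImmersion.cubic_eq`). When `∫ h² ≤ e`, `∫ f_s²` and `∫ f_ss²` are at most
multiples of `e`, and Young's inequality leaves `2 ∫ h² + C e²`. When `∫ h² ≥ e`, interpolation
bounds the cubic part directly by a multiple of `√e ∫ h²`, which is small against `4 ∫ h²`
(`dissipation_arith`). The only Sobolev inequality used is `sup g² ≤ 2 ∫ g² ds + ∫ g_s² ds`, with
constants independent of the length once `L ≥ 1`; hence the independence of `ω`.

The inequality `e' ≤ -7/4 e + 500 e²` holds as long as `e ≤ 1/40000`. A barrier argument shows that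
this persists, and integration of the inequality gives the decay
(`decay_of_small_differential_ineq`). Since the solution is only smooth up to `t = 0` from the
right, derivatives in time are taken within `[0, T)` throughout. -/

namespace ElasticFlow
open scoped ContDiff

/-! ### Arclength calculus on a smooth closed curve -/

/-- A smooth `2π`-periodic function: a smooth function on the parameter circle. -/
structure IsSmoothPeriodic {E : Type*} [NormedAddCommGroup E] [NormedSpace ℝ E]
    (f : ℝ → E) : Prop where
  contDiff : ContDiff ℝ ∞ f
  periodic : Function.Periodic f (2 * Real.pi)

/-- A smooth closed immersed plane curve, parametrised over a period `2π`. -/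
structure IsClosedImmersion (c : ℝ → ℂ) : Prop extends IsSmoothPeriodic c where
  immersed : ∀ u, deriv c u ≠ 0

namespace IsSmoothPeriodic

variable {E : Type*} [NormedAddCommGroup E] [NormedSpace ℝ E]

theorem const (a : E) : IsSmoothPeriodic (fun _ : ℝ => a) := ⟨contDiff_const, fun _ => rfl⟩

theorem add {f g : ℝ → E} (hf : IsSmoothPeriodic f) (hg : IsSmoothPeriodic g) :
    IsSmoothPeriodic (fun u => f u + g u) :=
  ⟨hf.contDiff.add hg.contDiff, fun u => by simp only [hf.periodic u, hg.periodic u]⟩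

theorem neg {f : ℝ → E} (hf : IsSmoothPeriodic f) : IsSmoothPeriodic (fun u => -f u) :=
  ⟨hf.contDiff.neg, fun u => by simp only [hf.periodic u]⟩

theorem sub {f g : ℝ → E} (hf : IsSmoothPeriodic f) (hg : IsSmoothPeriodic g) :
    IsSmoothPeriodic (fun u => f u - g u) :=
  ⟨hf.contDiff.sub hg.contDiff, fun u => by simp only [hf.periodic u, hg.periodic u]⟩

theorem smul {f : ℝ → ℝ} {g : ℝ → E} (hf : IsSmoothPeriodic f) (hg : IsSmoothPeriodic g) :
    IsSmoothPeriodic (fun u => f u • g u) :=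
  ⟨hf.contDiff.smul hg.contDiff, fun u => by simp only [hf.periodic u, hg.periodic u]⟩

theorem mul {f g : ℝ → ℝ} (hf : IsSmoothPeriodic f) (hg : IsSmoothPeriodic g) :
    IsSmoothPeriodic (fun u => f u * g u) := hf.smul hg

theorem pow {f : ℝ → ℝ} (hf : IsSmoothPeriodic f) (n : ℕ) :
    IsSmoothPeriodic (fun u => f u ^ n) :=
  ⟨hf.contDiff.pow n, fun u => by simp only [hf.periodic u]⟩

theorem inner {f g : ℝ → ℂ} (hf : IsSmoothPeriodic f) (hg : IsSmoothPeriodic g) :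
    IsSmoothPeriodic (fun u => inner ℝ (f u) (g u)) :=
  ⟨hf.contDiff.inner ℝ hg.contDiff, fun u => by simp only [hf.periodic u, hg.periodic u]⟩

theorem deriv {f : ℝ → E} (hf : IsSmoothPeriodic f) : IsSmoothPeriodic (deriv f) := by
  refine ⟨((contDiff_infty_iff_deriv (𝕜 := ℝ)).1 hf.contDiff).2, fun u => ?_⟩
  rw [← deriv_comp_add_const]
  exact congrArg (fun g => _root_.deriv g u) (funext hf.periodic)

theorem continuous {f : ℝ → E} (hf : IsSmoothPeriodic f) : Continuous f := hf.contDiff.continuous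

theorem hasDerivAt {f : ℝ → E} (hf : IsSmoothPeriodic f) (u : ℝ) :
    HasDerivAt f (_root_.deriv f u) u :=
  (hf.contDiff.differentiable (by simp) u).hasDerivAt

end IsSmoothPeriodic

namespace IsClosedImmersion

variable {c : ℝ → ℂ} {E : Type*} [NormedAddCommGroup E] [NormedSpace ℝ E]

theorem speed_pos (hc : IsClosedImmersion c) (u : ℝ) : 0 < speed c u :=
  norm_pos_iff.2 (hc.immersed u)

theorem smooth_speed (hc : IsClosedImmersion c) : IsSmoothPeriodic (speed c) :=
  ⟨hc.deriv.contDiff.norm ℝ hc.immersed, fun u => by simp only [speed, hc.deriv.periodic u]⟩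

theorem continuous_speed (hc : IsClosedImmersion c) : Continuous (speed c) :=
  hc.smooth_speed.continuous

theorem smooth_arcDeriv (hc : IsClosedImmersion c) {f : ℝ → E} (hf : IsSmoothPeriodic f) :
    IsSmoothPeriodic (arcDeriv c f) := by
  have h : IsSmoothPeriodic (fun u => (speed c u)⁻¹) :=
    ⟨hc.smooth_speed.contDiff.inv fun u => (hc.speed_pos u).ne',
      fun u => by simp only [hc.smooth_speed.periodic u]⟩
  exact h.smul hf.deriv

/-- `f' = |c'| f_s`. -/
theorem hasDerivAt (hc : IsClosedImmersion c) {f : ℝ → E} (hf : IsSmoothPeriodic f) (u : ℝ) :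
    HasDerivAt f (speed c u • arcDeriv c f u) u := by
  have := hf.hasDerivAt u
  rwa [arcDeriv, smul_inv_smul₀ (hc.speed_pos u).ne']

theorem smooth_tangent (hc : IsClosedImmersion c) : IsSmoothPeriodic (tangent c) :=
  hc.smooth_arcDeriv hc.toIsSmoothPeriodic

theorem smooth_normal (hc : IsClosedImmersion c) : IsSmoothPeriodic (normal c) :=
  ⟨contDiff_const.mul hc.smooth_tangent.contDiff,
    fun u => by simp only [normal, hc.smooth_tangent.periodic u]⟩

theorem smooth_curvature (hc : IsClosedImmersion c) : IsSmoothPeriodic (curvature c) :=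
  (hc.smooth_arcDeriv hc.smooth_tangent).inner hc.smooth_normal

theorem smooth_curvatureS (hc : IsClosedImmersion c) : IsSmoothPeriodic (curvatureS c) :=
  hc.smooth_arcDeriv hc.smooth_curvature

theorem smooth_curvatureSS (hc : IsClosedImmersion c) : IsSmoothPeriodic (curvatureSS c) :=
  hc.smooth_arcDeriv hc.smooth_curvatureS

theorem hasDerivAt_curvature (hc : IsClosedImmersion c) (u : ℝ) :
    HasDerivAt (curvature c) (speed c u * curvatureS c u) u :=
  hc.hasDerivAt hc.smooth_curvature u

theorem hasDerivAt_curvatureS (hc : IsClosedImmersion c) (u : ℝ) :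
    HasDerivAt (curvatureS c) (speed c u * curvatureSS c u) u :=
  hc.hasDerivAt hc.smooth_curvatureS u

theorem norm_tangent (hc : IsClosedImmersion c) (u : ℝ) : ‖tangent c u‖ = 1 := by
  have := hc.speed_pos u
  rw [tangent, arcDeriv, norm_smul, norm_inv, Real.norm_of_nonneg this.le]
  exact inv_mul_cancel₀ this.ne'

theorem inner_tangent_tangent (hc : IsClosedImmersion c) (u : ℝ) :
    inner ℝ (tangent c u) (tangent c u) = 1 := by
  rw [real_inner_self_eq_norm_sq, hc.norm_tangent, one_pow]

end IsClosedImmersion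

theorem inner_tangent_normal (c : ℝ → ℂ) (u : ℝ) :
    inner ℝ (tangent c u) (normal c u) = 0 := by
  simp only [normal, Complex.inner, Complex.mul_re, Complex.mul_im, Complex.conj_re,
    Complex.conj_im, Complex.I_re, Complex.I_im]
  ring

theorem inner_normal_normal {c : ℝ → ℂ} (hc : IsClosedImmersion c) (u : ℝ) :
    inner ℝ (normal c u) (normal c u) = 1 := by
  rw [real_inner_self_eq_norm_sq, normal, norm_mul, Complex.norm_I, hc.norm_tangent]
  norm_num

/-- Any vector orthogonal to a unit complex number `z` is a multiple of `i z`. -/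
theorem eq_inner_smul_I_mul {z w : ℂ} (hz : ‖z‖ = 1) (h : inner ℝ w z = 0) :
    w = (inner ℝ w (Complex.I * z) : ℝ) • (Complex.I * z) := by
  have hz' : z.re * z.re + z.im * z.im = 1 := by
    have := Complex.normSq_eq_norm_sq z
    rw [Complex.normSq_apply, hz] at this
    simpa using this
  simp only [Complex.inner, Complex.mul_re, Complex.mul_im, Complex.conj_re,
    Complex.conj_im, Complex.I_re, Complex.I_im] at h ⊢
  apply Complex.ext
  · simp only [Complex.real_smul, Complex.mul_re, Complex.mul_im, Complex.I_re, Complex.I_im,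
      Complex.ofReal_re, Complex.ofReal_im]
    linear_combination (-w.re) * hz' + z.re * h
  · simp only [Complex.real_smul, Complex.mul_re, Complex.mul_im, Complex.I_re, Complex.I_im,
      Complex.ofReal_re, Complex.ofReal_im]
    linear_combination (-w.im) * hz' + z.im * h

namespace IsClosedImmersion

variable {c : ℝ → ℂ}

/-- The first Frenet equation `τ_s = k ν`. -/
theorem arcDeriv_tangent (hc : IsClosedImmersion c) (u : ℝ) :
    arcDeriv c (tangent c) u = curvature c u • normal c u := by
  have h := (hc.hasDerivAt hc.smooth_tangent u).inner ℝ (hc.hasDerivAt hc.smooth_tangent u)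
  have h1 : (fun u => inner ℝ (tangent c u) (tangent c u)) = fun _ => (1 : ℝ) :=
    funext hc.inner_tangent_tangent
  rw [h1] at h
  have h2 := h.unique (hasDerivAt_const u (1 : ℝ))
  rw [inner_smul_left, inner_smul_right,
    real_inner_comm (arcDeriv c (tangent c) u) (tangent c u)] at h2
  have h3 : inner ℝ (arcDeriv c (tangent c) u) (tangent c u) = 0 := by
    have := (hc.speed_pos u).ne'
    have h4 : 2 * speed c u * inner ℝ (arcDeriv c (tangent c) u) (tangent c u) = 0 := by
      simp only [conj_trivial] at h2
      linarith
    simpa [this] using h4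
  exact eq_inner_smul_I_mul (hc.norm_tangent u) h3

theorem hasDerivAt_tangent (hc : IsClosedImmersion c) (u : ℝ) :
    HasDerivAt (tangent c) ((speed c u * curvature c u) • normal c u) u := by
  have := hc.hasDerivAt hc.smooth_tangent u
  rwa [hc.arcDeriv_tangent, smul_smul] at this

/-- The second Frenet equation `ν_s = -k τ`. -/
theorem hasDerivAt_normal (hc : IsClosedImmersion c) (u : ℝ) :
    HasDerivAt (normal c) (-(speed c u * curvature c u) • tangent c u) u := by
  have h : HasDerivAt (normal c) _ u := (hc.hasDerivAt_tangent u).const_mul Complex.I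
  convert h using 1
  simp only [Complex.real_smul, normal]
  push_cast
  linear_combination (-(speed c u * curvature c u * tangent c u : ℂ)) * Complex.I_mul_I

theorem hasDerivAt_self (hc : IsClosedImmersion c) (u : ℝ) :
    HasDerivAt c (speed c u • tangent c u) u :=
  hc.hasDerivAt hc.toIsSmoothPeriodic u

end IsClosedImmersion

/-! ### Integration along the curve -/

section Integral

variable {c : ℝ → ℂ}

theorem arcIntegral_add (hc : Continuous (speed c)) {f g : ℝ → ℝ} (hf : Continuous f)
    (hg : Continuous g) :
    arcIntegral c (fun u => f u + g u) = arcIntegral c f + arcIntegral c g := by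
  simp only [arcIntegral, add_mul]
  exact intervalIntegral.integral_add ((hf.mul hc).intervalIntegrable _ _)
    ((hg.mul hc).intervalIntegrable _ _)

theorem arcIntegral_sub (hc : Continuous (speed c)) {f g : ℝ → ℝ} (hf : Continuous f)
    (hg : Continuous g) :
    arcIntegral c (fun u => f u - g u) = arcIntegral c f - arcIntegral c g := by
  simp only [arcIntegral, sub_mul]
  exact intervalIntegral.integral_sub ((hf.mul hc).intervalIntegrable _ _)
    ((hg.mul hc).intervalIntegrable _ _)

theorem arcIntegral_const_mul (a : ℝ) (f : ℝ → ℝ) :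
    arcIntegral c (fun u => a * f u) = a * arcIntegral c f := by
  simp only [arcIntegral, mul_assoc]
  exact intervalIntegral.integral_const_mul _ _

theorem arcIntegral_const (a : ℝ) : arcIntegral c (fun _ => a) = a * length c := by
  simpa [length] using arcIntegral_const_mul (c := c) a (fun _ => 1)

theorem arcIntegral_mono (hc : Continuous (speed c)) {f g : ℝ → ℝ} (hf : Continuous f)
    (hg : Continuous g) (h : ∀ u ∈ Set.Icc 0 (2 * Real.pi), f u ≤ g u) :
    arcIntegral c f ≤ arcIntegral c g :=
  intervalIntegral.integral_mono_on (by positivity) ((hf.mul hc).intervalIntegrable _ _)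
    ((hg.mul hc).intervalIntegrable _ _)
    fun u hu => mul_le_mul_of_nonneg_right (h u hu) (norm_nonneg _)

theorem arcIntegral_nonneg {f : ℝ → ℝ} (h : ∀ u, 0 ≤ f u) : 0 ≤ arcIntegral c f :=
  intervalIntegral.integral_nonneg (by positivity) fun u _ => mul_nonneg (h u) (norm_nonneg _)

theorem IsClosedImmersion.length_pos (hc : IsClosedImmersion c) : 0 < length c :=
  intervalIntegral.intervalIntegral_pos_of_pos
    ((continuous_const.mul hc.continuous_speed).intervalIntegrable _ _)
    (fun u => by simpa using hc.speed_pos u) (by positivity)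

/-- The arclength derivative of a function on a closed curve has integral zero. In this form the
derivative is given as a function `g` with `f' = |c'| g`. -/
theorem IsClosedImmersion.arcIntegral_eq_zero (hc : IsClosedImmersion c) {f g : ℝ → ℝ}
    (hf : Function.Periodic f (2 * Real.pi)) (hg : Continuous g)
    (h : ∀ u, HasDerivAt f (speed c u * g u) u) : arcIntegral c g = 0 := by
  have h1 : arcIntegral c g = f (2 * Real.pi) - f 0 := by
    simp only [arcIntegral]
    refine intervalIntegral.integral_eq_sub_of_hasDerivAt (fun u _ => ?_)
      ((hg.mul hc.continuous_speed).intervalIntegrable _ _)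
    simpa only [mul_comm] using h u
  have h2 := hf 0
  rw [zero_add] at h2
  rw [h1, h2, sub_self]

/-- The Cauchy–Schwarz inequality for `∫ f g ds`. -/
theorem arcIntegral_mul_sq_le (hc : Continuous (speed c)) {f g : ℝ → ℝ} (hf : Continuous f)
    (hg : Continuous g) :
    arcIntegral c (fun u => f u * g u) ^ 2
      ≤ arcIntegral c (fun u => f u ^ 2) * arcIntegral c (fun u => g u ^ 2) := by
  have h : ∀ x : ℝ, 0 ≤ arcIntegral c (fun u => f u ^ 2) * (x * x)
      + (2 * arcIntegral c (fun u => f u * g u)) * x + arcIntegral c (fun u => g u ^ 2) := by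
    intro x
    have h0 : 0 ≤ arcIntegral c (fun u => (x * f u + g u) ^ 2) :=
      arcIntegral_nonneg fun u => sq_nonneg _
    have h1 : (fun u => (x * f u + g u) ^ 2)
        = fun u => (x * x) * f u ^ 2 + (2 * x) * (f u * g u) + g u ^ 2 := by
      funext u; ring
    rw [h1, arcIntegral_add hc (by fun_prop) (by fun_prop),
      arcIntegral_add hc (by fun_prop) (by fun_prop), arcIntegral_const_mul,
      arcIntegral_const_mul] at h0
    linarith
  have := discrim_le_zero h
  rw [discrim] at this
  linarith

/-- The Sobolev inequality `sup g² ≤ 2 ∫ g² ds + ∫ g_s² ds` on a curve of length at least one. -/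
theorem IsClosedImmersion.sq_le_arcIntegral (hc : IsClosedImmersion c) (hL : 1 ≤ length c)
    {g g' : ℝ → ℝ} (hg : Continuous g) (hg' : Continuous g')
    (h : ∀ u, HasDerivAt g (speed c u * g' u) u) {u : ℝ} (hu : u ∈ Set.Icc 0 (2 * Real.pi)) :
    g u ^ 2 ≤ 2 * arcIntegral c (fun u => g u ^ 2) + arcIntegral c (fun u => g' u ^ 2) := by
  have hv := hc.continuous_speed
  have hpi : (0 : ℝ) ≤ 2 * Real.pi := by positivity
  -- The minimum of `g²` is at most its mean value, hence at most `∫ g² ds`.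
  obtain ⟨w, hw, hmin⟩ := isCompact_Icc.exists_isMinOn (Set.nonempty_Icc.2 hpi)
    ((hg.pow 2).continuousOn (s := Set.Icc 0 (2 * Real.pi)))
  have h1 : g w ^ 2 ≤ arcIntegral c (fun u => g u ^ 2) := by
    have := arcIntegral_mono (f := fun _ => g w ^ 2) (g := fun u => g u ^ 2) hv
      continuous_const (hg.pow 2) fun u hu => hmin hu
    rw [arcIntegral_const] at this
    nlinarith [sq_nonneg (g w)]
  have h2 : ∫ x in w..u, 2 * g x * (speed c x * g' x) = g u ^ 2 - g w ^ 2 := by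
    refine intervalIntegral.integral_eq_sub_of_hasDerivAt (f := fun x => g x ^ 2)
      (fun x _ => ?_) (Continuous.intervalIntegrable (by fun_prop) _ _)
    simpa using (h x).fun_pow 2
  have h3 : ∫ x in w..u, 2 * g x * (speed c x * g' x)
      ≤ arcIntegral c (fun u => g u ^ 2 + g' u ^ 2) := by
    refine (Real.le_norm_self _).trans ?_
    have hcont : Continuous fun x => ‖2 * g x * (speed c x * g' x)‖ := by fun_prop
    calc ‖∫ x in w..u, 2 * g x * (speed c x * g' x)‖
        ≤ ∫ x in Set.uIoc w u, ‖2 * g x * (speed c x * g' x)‖ :=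
          intervalIntegral.norm_integral_le_integral_norm_uIoc
      _ ≤ ∫ x in Set.Ioc 0 (2 * Real.pi), ‖2 * g x * (speed c x * g' x)‖ := by
          refine MeasureTheory.setIntegral_mono_set (hcont.integrableOn_Ioc)
            (Filter.Eventually.of_forall fun _ => norm_nonneg _)
            (Set.Ioc_subset_Ioc (le_min hw.1 hu.1) (max_le hw.2 hu.2)).eventuallyLE
      _ = ∫ x in (0 : ℝ)..(2 * Real.pi), ‖2 * g x * (speed c x * g' x)‖ :=
          (intervalIntegral.integral_of_le hpi).symm
      _ ≤ _ := by
          refine intervalIntegral.integral_mono_on hpi (hcont.intervalIntegrable _ _)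
            (Continuous.intervalIntegrable (by fun_prop) _ _) fun x _ => ?_
          have hs := (hc.speed_pos x).le
          rw [show 2 * g x * (speed c x * g' x) = (2 * g x * g' x) * speed c x by ring, norm_mul,
            Real.norm_of_nonneg hs, Real.norm_eq_abs]
          refine mul_le_mul_of_nonneg_right (abs_le.2 ⟨?_, ?_⟩) hs <;>
            nlinarith [sq_nonneg (g x + g' x), sq_nonneg (g x - g' x)]
  rw [arcIntegral_add hv (by fun_prop) (by fun_prop)] at h3
  linarith

end Integral

/-! ### Integral identities for closed curves -/

namespace IsClosedImmersion

variable {c : ℝ → ℂ}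

/-- The Minkowski identity `∫ k ⟨c, ν⟩ ds = -L`. -/
theorem arcIntegral_curvature_mul_support (hc : IsClosedImmersion c) :
    arcIntegral c (fun u => curvature c u * inner ℝ (c u) (normal c u)) = -length c := by
  have hv := hc.continuous_speed
  have hp := (hc.inner hc.smooth_normal).continuous
  have hk := hc.smooth_curvature.continuous
  have h := hc.arcIntegral_eq_zero (hc.inner hc.smooth_tangent).periodic
    (g := fun u => curvature c u * inner ℝ (c u) (normal c u) + 1) (by fun_prop) fun u => by
      refine ((hc.hasDerivAt_self u).inner ℝ (hc.hasDerivAt_tangent u)).congr_deriv ?_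
      rw [inner_smul_left, inner_smul_right, hc.inner_tangent_tangent]
      simp only [conj_trivial]
      ring
  rw [arcIntegral_add hv (by fun_prop) (by fun_prop), arcIntegral_const] at h
  linarith

/-- The variation of `∫ k² ds` under dilations: `∫ (2 k_ss + k³) ⟨c, ν⟩ ds = -∫ k² ds`. -/
theorem arcIntegral_gradient_mul_support (hc : IsClosedImmersion c) :
    arcIntegral c (fun u => (2 * curvatureSS c u + curvature c u ^ 3)
        * inner ℝ (c u) (normal c u))
      = -arcIntegral c (fun u => curvature c u ^ 2) := by
  have hv := hc.continuous_speed
  have hp := (hc.inner hc.smooth_normal).continuous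
  have hk := hc.smooth_curvature.continuous
  have hkss := hc.smooth_curvatureSS.continuous
  -- The integrand plus `k²` is the arclength derivative of `2 k_s ⟨c, ν⟩ + k² ⟨c, τ⟩`.
  have h := hc.arcIntegral_eq_zero
    (f := fun u => 2 * (curvatureS c u * inner ℝ (c u) (normal c u))
      + curvature c u ^ 2 * inner ℝ (c u) (tangent c u))
    (g := fun u => (2 * curvatureSS c u + curvature c u ^ 3) * inner ℝ (c u) (normal c u)
      + curvature c u ^ 2)
    (((IsSmoothPeriodic.const (2 : ℝ)).mul
      (hc.smooth_curvatureS.mul (hc.inner hc.smooth_normal))).add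
      ((hc.smooth_curvature.pow 2).mul (hc.inner hc.smooth_tangent))).periodic
    (by fun_prop) fun u => by
      have hT := (hc.hasDerivAt_self u).inner ℝ (hc.hasDerivAt_tangent u)
      have hN := (hc.hasDerivAt_self u).inner ℝ (hc.hasDerivAt_normal u)
      refine ((((hc.hasDerivAt_curvatureS u).fun_mul hN).const_mul 2).fun_add
        (((hc.hasDerivAt_curvature u).fun_pow 2).fun_mul hT)).congr_deriv ?_
      simp only [inner_smul_left, inner_smul_right, hc.inner_tangent_tangent,
        inner_tangent_normal, conj_trivial]
      push_cast
      ring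
  rw [arcIntegral_add hv (by fun_prop) (by fun_prop)] at h
  linarith

/-- The first variation of length paired with the gradient of `∫ k² ds`:
`∫ k (2 k_ss + k³) ds = -2 ∫ k_s² ds + ∫ k⁴ ds`. -/
theorem arcIntegral_curvature_mul_gradient (hc : IsClosedImmersion c) :
    arcIntegral c (fun u => curvature c u * (2 * curvatureSS c u + curvature c u ^ 3))
      = -2 * arcIntegral c (fun u => curvatureS c u ^ 2)
        + arcIntegral c (fun u => curvature c u ^ 4) := by
  have hv := hc.continuous_speed
  have hk := hc.smooth_curvature.continuous
  have hks := hc.smooth_curvatureS.continuous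
  have hkss := hc.smooth_curvatureSS.continuous
  have h := hc.arcIntegral_eq_zero
    (g := fun u => curvatureS c u ^ 2 + curvature c u * curvatureSS c u)
    (hc.smooth_curvature.mul hc.smooth_curvatureS).periodic
    (by fun_prop) fun u => by
      refine ((hc.hasDerivAt_curvature u).fun_mul (hc.hasDerivAt_curvatureS u)).congr_deriv ?_
      ring
  rw [arcIntegral_add hv (by fun_prop) (by fun_prop)] at h
  rw [show (fun u => curvature c u * (2 * curvatureSS c u + curvature c u ^ 3))
      = fun u => 2 * (curvature c u * curvatureSS c u) + curvature c u ^ 4 by funext u; ring,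
    arcIntegral_add hv (by fun_prop) (by fun_prop), arcIntegral_const_mul]
  linarith

end IsClosedImmersion

/-! ### The dissipation inequality -/

/-- The algebraic core of the dissipation inequality. The letters stand for
`e = ∫ f²`, `D = ∫ f_s²`, `S = ∫ f_ss²`, `H = ∫ (f_ss + 5/4 f)²`, `K = 24 ∫ f f_s² - 16 ∫ f³`, and
`R` for the terms of order at least four. The bound `hK₁` is used when `H ≤ e`, and the bound `hK₂`
(with `m = sup |f|`) when `e ≤ H`. -/
theorem dissipation_arith {e D S H K R m : ℝ} (he0 : 0 ≤ e) (he : e ≤ 1 / 40000)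
    (hD0 : 0 ≤ D) (hD : D ^ 2 ≤ e * S) (hH0 : 0 ≤ H) (hH : H = S - 5 / 2 * D + 25 / 16 * e)
    (hS : S ≤ 2 * H + 25 / 8 * e) (hm0 : 0 ≤ m) (hm : m ^ 2 = 2 * e + D)
    (hK₁ : K ≤ 2 * H + 41 * (2 * e + D) * e + (2 * D + S) * D)
    (hK₂ : K ≤ 24 * m * D + 16 * m * e)
    (hR : R ≤ 12 * (2 * e + D) * D + 8 * e ^ 2 + 3 * (2 * e + D) * e ^ 2) :
    -4 * S + 10 * D - 8 * e + K + R ≤ -(7 / 4) * e + 500 * e ^ 2 := by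
  have hquad : -4 * S + 10 * D - 8 * e = -4 * H - 7 / 4 * e := by rw [hH]; ring
  rw [hquad]
  rcases le_total H e with hle | hle
  · have hD3 : D ≤ 3 * e := by
      refine le_of_sq_le_sq ?_ (by positivity)
      nlinarith
    have h1 : (2 * D + S) * D ≤ 12 * e * (3 * e) :=
      mul_le_mul (by linarith) hD3 hD0 (by positivity)
    have h2 : (2 * e + D) * D ≤ 5 * e * (3 * e) :=
      mul_le_mul (by linarith) hD3 hD0 (by positivity)
    have h3 : (2 * e + D) * e ≤ 5 * e * e := mul_le_mul_of_nonneg_right (by linarith) he0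
    have h4 : (2 * e + D) * e ^ 2 ≤ 1 * e ^ 2 :=
      mul_le_mul_of_nonneg_right (by linarith) (by positivity)
    nlinarith
  · -- Everything is measured by `q = √(e H)`, which lies between `e` and `H`.
    obtain ⟨q, hq0, hq⟩ : ∃ q, 0 ≤ q ∧ q ^ 2 = e * H :=
      ⟨√(e * H), Real.sqrt_nonneg _, Real.sq_sqrt (by positivity)⟩
    have heq : e ≤ q := le_of_sq_le_sq (by nlinarith) hq0
    have hqH : q ≤ H := le_of_sq_le_sq (by nlinarith) hH0
    have hDq : D ≤ 3 * q := le_of_sq_le_sq (by nlinarith) (by positivity)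
    -- The cubic terms are at most `(24 * 3 + 16) m q = 88 m q`, and `(m q)² ≤ 5 e H²`; the bound on
    -- `e` is chosen so that `5 * 88² * e ≤ 1`.
    have h1 : (m * q) ^ 2 ≤ (H / 88) ^ 2 := by
      have ha : m ^ 2 ≤ 5 * H := by linarith
      have hb : m ^ 2 * q ^ 2 ≤ 5 * H * (e * H) := by
        rw [hq]; exact mul_le_mul_of_nonneg_right ha (by positivity)
      have hc : e * H ^ 2 ≤ 1 / 40000 * H ^ 2 := mul_le_mul_of_nonneg_right he (by positivity)
      nlinarith
    have h2 : m * q ≤ H / 88 := le_of_sq_le_sq h1 (by positivity)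
    have h3 : m * D ≤ m * (3 * q) := mul_le_mul_of_nonneg_left hDq hm0
    have h4 : m * e ≤ m * q := mul_le_mul_of_nonneg_left heq hm0
    have h5 : (2 * e + D) * D ≤ 5 * q * (3 * q) :=
      mul_le_mul (by linarith) hDq hD0 (by positivity)
    have h6 : e * H ≤ 1 / 40000 * H := mul_le_mul_of_nonneg_right he hH0
    have h7 : e ^ 2 ≤ e * H := by nlinarith
    have h8 : (2 * e + D) * e ^ 2 ≤ 5 * H * e ^ 2 :=
      mul_le_mul_of_nonneg_right (by linarith) (by positivity)
    have h9 : H * e ^ 2 ≤ 1 / 40000 * H := by nlinarith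
    nlinarith

theorem arcIntegral_le_add {c : ℝ → ℂ} (hv : Continuous (speed c)) {f g h : ℝ → ℝ}
    (hf : Continuous f) (hg : Continuous g) (hh : Continuous h) {x y : ℝ}
    (H : ∀ u ∈ Set.Icc 0 (2 * Real.pi), f u ≤ x * g u + y * h u) :
    arcIntegral c f ≤ x * arcIntegral c g + y * arcIntegral c h := by
  rw [← arcIntegral_const_mul, ← arcIntegral_const_mul,
    ← arcIntegral_add hv (by fun_prop) (by fun_prop)]
  exact arcIntegral_mono hv hf (by fun_prop) H

/-- The integral of a product with a bounded first factor. -/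
theorem arcIntegral_sq_mul_le {c : ℝ → ℂ} (hv : Continuous (speed c)) {f g : ℝ → ℝ} {M : ℝ}
    (hf : Continuous f) (hg : Continuous g)
    (hM : ∀ u ∈ Set.Icc 0 (2 * Real.pi), f u ^ 2 ≤ M) :
    arcIntegral c (fun u => f u ^ 2 * g u ^ 2) ≤ M * arcIntegral c (fun u => g u ^ 2) := by
  rw [← arcIntegral_const_mul]
  exact arcIntegral_mono hv (by fun_prop) (by fun_prop) fun u hu =>
    mul_le_mul_of_nonneg_right (hM u hu) (sq_nonneg _)

/-- The cubic terms in terms of `h = f_ss + 5/4 f`, where `a = f_s` and `b = f_ss`. Besides the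
definition of `h`, this uses `∫ f f_s² ds = -1/2 ∫ f² f_ss ds` and `∫ f_ss f_s² ds = 0`. -/
theorem IsClosedImmersion.cubic_eq {c : ℝ → ℂ} (hc : IsClosedImmersion c)
    {f a b : ℝ → ℝ} (hf : IsSmoothPeriodic f) (ha : IsSmoothPeriodic a)
    (hb : Continuous b) (hfa : ∀ u, HasDerivAt f (speed c u * a u) u)
    (hab : ∀ u, HasDerivAt a (speed c u * b u) u) :
    24 * arcIntegral c (fun u => f u * a u ^ 2) - 16 * arcIntegral c (fun u => f u ^ 3)
      = -(64 / 5) * arcIntegral c (fun u => f u ^ 2 * (b u + 5 / 4 * f u))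
        - 32 / 25 * arcIntegral c (fun u => (b u + 5 / 4 * f u) * a u ^ 2) := by
  have hv := hc.continuous_speed
  have hfc := hf.continuous
  have hac := ha.continuous
  have h1 : arcIntegral c (fun u => f u * a u ^ 2)
      + 1 / 2 * arcIntegral c (fun u => f u ^ 2 * b u) = 0 := by
    rw [← arcIntegral_const_mul, ← arcIntegral_add hv (by fun_prop) (by fun_prop)]
    refine hc.arcIntegral_eq_zero
      (((IsSmoothPeriodic.const (1 / 2 : ℝ)).mul (hf.pow 2)).mul ha).periodic (by fun_prop)
      fun u => ?_
    refine ((((hfa u).fun_pow 2).const_mul (1 / 2)).fun_mul (hab u)).congr_deriv ?_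
    push_cast
    ring
  have h2 : arcIntegral c (fun u => b u * a u ^ 2) = 0 := by
    refine hc.arcIntegral_eq_zero
      ((IsSmoothPeriodic.const (1 / 3 : ℝ)).mul (ha.pow 3)).periodic (by fun_prop) fun u => ?_
    refine (((hab u).fun_pow 3).const_mul (1 / 3)).congr_deriv ?_
    push_cast
    ring
  have h3 : arcIntegral c (fun u => f u ^ 2 * (b u + 5 / 4 * f u))
      = arcIntegral c (fun u => f u ^ 2 * b u) + 5 / 4 * arcIntegral c (fun u => f u ^ 3) := by
    rw [← arcIntegral_const_mul, ← arcIntegral_add hv (by fun_prop) (by fun_prop)]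
    congr 1; funext u; ring
  have h4 : arcIntegral c (fun u => (b u + 5 / 4 * f u) * a u ^ 2)
      = arcIntegral c (fun u => b u * a u ^ 2)
        + 5 / 4 * arcIntegral c (fun u => f u * a u ^ 2) := by
    rw [← arcIntegral_const_mul, ← arcIntegral_add hv (by fun_prop) (by fun_prop)]
    congr 1; funext u; ring
  linarith

/-- The cubic terms are controlled by `∫ (f_ss + 5/4 f)² ds` and quartic terms. -/
theorem IsClosedImmersion.cubic_le {c : ℝ → ℂ} (hc : IsClosedImmersion c)
    {f a b : ℝ → ℝ} (hf : IsSmoothPeriodic f) (ha : IsSmoothPeriodic a)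
    (hb : Continuous b) (hfa : ∀ u, HasDerivAt f (speed c u * a u) u)
    (hab : ∀ u, HasDerivAt a (speed c u * b u) u) :
    24 * arcIntegral c (fun u => f u * a u ^ 2) - 16 * arcIntegral c (fun u => f u ^ 3)
      ≤ 2 * arcIntegral c (fun u => (b u + 5 / 4 * f u) ^ 2)
        + 41 * arcIntegral c (fun u => f u ^ 4) + arcIntegral c (fun u => a u ^ 4) := by
  have hv := hc.continuous_speed
  have hfc := hf.continuous
  have hac := ha.continuous
  rw [hc.cubic_eq hf ha hb hfa hab]
  have h1 : -(64 / 5) * arcIntegral c (fun u => f u ^ 2 * (b u + 5 / 4 * f u))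
      ≤ 1 * arcIntegral c (fun u => (b u + 5 / 4 * f u) ^ 2)
        + 41 * arcIntegral c (fun u => f u ^ 4) := by
    rw [← arcIntegral_const_mul]
    refine arcIntegral_le_add hv (by fun_prop) (by fun_prop) (by fun_prop) fun u _ => ?_
    linarith [sq_nonneg (b u + 5 / 4 * f u + 32 / 5 * f u ^ 2), sq_nonneg (f u ^ 2)]
  have h2 : -(32 / 25) * arcIntegral c (fun u => (b u + 5 / 4 * f u) * a u ^ 2)
      ≤ 1 * arcIntegral c (fun u => (b u + 5 / 4 * f u) ^ 2)
        + 1 * arcIntegral c (fun u => a u ^ 4) := by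
    rw [← arcIntegral_const_mul]
    refine arcIntegral_le_add hv (by fun_prop) (by fun_prop) (by fun_prop) fun u _ => ?_
    linarith [sq_nonneg (b u + 5 / 4 * f u + 16 / 25 * a u ^ 2), sq_nonneg (a u ^ 2)]
  linarith

theorem arcIntegral_one_add_sq {c : ℝ → ℂ} (hv : Continuous (speed c)) {f : ℝ → ℝ}
    (hf : Continuous f) (hmean : arcIntegral c f = 0) :
    arcIntegral c (fun u => (1 + f u) ^ 2) = length c + arcIntegral c (fun u => f u ^ 2) := by
  rw [show (fun u => (1 + f u) ^ 2) = fun u => 1 + 2 * f u + f u ^ 2 by funext u; ring,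
    arcIntegral_add hv (by fun_prop) (by fun_prop),
    arcIntegral_add hv (by fun_prop) (by fun_prop), arcIntegral_const_mul, hmean,
    arcIntegral_const]
  ring

theorem arcIntegral_one_add_pow_four {c : ℝ → ℂ} (hv : Continuous (speed c)) {f : ℝ → ℝ}
    (hf : Continuous f) (hmean : arcIntegral c f = 0) :
    arcIntegral c (fun u => (1 + f u) ^ 4)
      = length c + 6 * arcIntegral c (fun u => f u ^ 2) + 4 * arcIntegral c (fun u => f u ^ 3)
        + arcIntegral c (fun u => f u ^ 4) := by
  rw [show (fun u => (1 + f u) ^ 4)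
    = fun u => 1 + 4 * f u + 6 * f u ^ 2 + 4 * f u ^ 3 + f u ^ 4 by funext u; ring,
    arcIntegral_add hv (by fun_prop) (by fun_prop),
    arcIntegral_add hv (by fun_prop) (by fun_prop),
    arcIntegral_add hv (by fun_prop) (by fun_prop),
    arcIntegral_add hv (by fun_prop) (by fun_prop), arcIntegral_const_mul,
    arcIntegral_const_mul, arcIntegral_const_mul, hmean, arcIntegral_const]
  ring

/-- Expansion of `∫ (2 k_ss + k³)² ds` around `k = 1`, in terms of `f = k - 1`, `a = f_s`,
`b = f_ss`. The mixed term is integrated by parts: `∫ k³ k_ss ds = -3 ∫ k² k_s² ds`. -/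
theorem IsClosedImmersion.arcIntegral_gradient_sq {c : ℝ → ℂ} (hc : IsClosedImmersion c)
    {f a b : ℝ → ℝ} (hf : IsSmoothPeriodic f) (ha : IsSmoothPeriodic a)
    (hb : Continuous b) (hfa : ∀ u, HasDerivAt f (speed c u * a u) u)
    (hab : ∀ u, HasDerivAt a (speed c u * b u) u) (hmean : arcIntegral c f = 0) :
    arcIntegral c (fun u => (2 * b u + (1 + f u) ^ 3) ^ 2)
      = 4 * arcIntegral c (fun u => b u ^ 2)
        + (length c + 15 * arcIntegral c (fun u => f u ^ 2)
          + 20 * arcIntegral c (fun u => f u ^ 3) + 15 * arcIntegral c (fun u => f u ^ 4)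
          + 6 * arcIntegral c (fun u => f u ^ 5) + arcIntegral c (fun u => f u ^ 6))
        - 12 * (arcIntegral c (fun u => a u ^ 2) + 2 * arcIntegral c (fun u => f u * a u ^ 2)
          + arcIntegral c (fun u => f u ^ 2 * a u ^ 2)) := by
  have hv := hc.continuous_speed
  have hfc := hf.continuous
  have hac := ha.continuous
  have h0 : arcIntegral c (fun u => 3 * (1 + f u) ^ 2 * a u ^ 2 + (1 + f u) ^ 3 * b u) = 0 := by
    refine hc.arcIntegral_eq_zero
      ((((IsSmoothPeriodic.const (1 : ℝ)).add hf).pow 3).mul ha).periodic (by fun_prop)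
      fun u => ?_
    refine ((((hfa u).const_add 1).fun_pow 3).fun_mul (hab u)).congr_deriv ?_
    push_cast
    ring
  rw [show (fun u => (2 * b u + (1 + f u) ^ 3) ^ 2)
    = fun u => 4 * b u ^ 2 + (1 + 6 * f u + 15 * f u ^ 2 + 20 * f u ^ 3 + 15 * f u ^ 4
        + 6 * f u ^ 5 + f u ^ 6) - 12 * (a u ^ 2 + 2 * (f u * a u ^ 2) + f u ^ 2 * a u ^ 2)
        + 4 * (3 * (1 + f u) ^ 2 * a u ^ 2 + (1 + f u) ^ 3 * b u) by funext u; ring]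
  rw [arcIntegral_add hv (by fun_prop) (by fun_prop),
    arcIntegral_sub hv (by fun_prop) (by fun_prop),
    arcIntegral_add hv (by fun_prop) (by fun_prop),
    arcIntegral_add hv (by fun_prop) (by fun_prop),
    arcIntegral_add hv (by fun_prop) (by fun_prop),
    arcIntegral_add hv (by fun_prop) (by fun_prop),
    arcIntegral_add hv (by fun_prop) (by fun_prop),
    arcIntegral_add hv (by fun_prop) (by fun_prop),
    arcIntegral_add hv (by fun_prop) (by fun_prop)]
  simp only [arcIntegral_const_mul]
  rw [arcIntegral_add hv (by fun_prop) (by fun_prop),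
    arcIntegral_add hv (by fun_prop) (by fun_prop), h0]
  simp only [arcIntegral_const_mul, hmean, arcIntegral_const]
  ring

/-- The dissipation inequality for `f = k - 1`: when `∫ f ds = 0`, the right-hand side of the
evolution equation of `e = ∫ f² ds` is at most `-7/4 e + 500 e²`, provided `e` is small.

The quadratic part of the left-hand side is `-4 ∫ (f_ss + 5/4 f)² - 7/4 ∫ f²`, which has no
slack on functions with `f_ss = -5/4 f`. The cubic part is controlled all the same because it
vanishes on such functions: it equals `-64/5 ∫ f² h - 32/25 ∫ h f_s²` with `h = f_ss + 5/4 f`. -/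
theorem IsClosedImmersion.dissipation_le {c : ℝ → ℂ} (hc : IsClosedImmersion c)
    (hL : 1 ≤ length c) {f a b : ℝ → ℝ} (hf : IsSmoothPeriodic f) (ha : IsSmoothPeriodic a)
    (hb : Continuous b) (hfa : ∀ u, HasDerivAt f (speed c u * a u) u)
    (hab : ∀ u, HasDerivAt a (speed c u * b u) u) (hmean : arcIntegral c f = 0)
    (he : arcIntegral c (fun u => f u ^ 2) ≤ 1 / 40000) :
    -arcIntegral c (fun u => (2 * b u + (1 + f u) ^ 3) ^ 2)
      - (length c)⁻¹ * (2 * arcIntegral c (fun u => a u ^ 2)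
          - arcIntegral c (fun u => (1 + f u) ^ 4)) * arcIntegral c (fun u => (1 + f u) ^ 2)
      ≤ -(7 / 4) * arcIntegral c (fun u => f u ^ 2)
        + 500 * arcIntegral c (fun u => f u ^ 2) ^ 2 := by
  have hv := hc.continuous_speed
  have hfc := hf.continuous
  have hac := ha.continuous
  set e := arcIntegral c (fun u => f u ^ 2)
  set D := arcIntegral c (fun u => a u ^ 2) with hD_def
  set S := arcIntegral c (fun u => b u ^ 2)
  set H := arcIntegral c (fun u => (b u + 5 / 4 * f u) ^ 2) with hH_def
  set A₃ := arcIntegral c (fun u => f u ^ 3) with hA₃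
  set A₄ := arcIntegral c (fun u => f u ^ 4)
  set A₅ := arcIntegral c (fun u => f u ^ 5) with hA₅
  set A₆ := arcIntegral c (fun u => f u ^ 6)
  set P := arcIntegral c (fun u => f u * a u ^ 2) with hP
  set Q := arcIntegral c (fun u => f u ^ 2 * a u ^ 2)
  set L := length c
  have he0 : 0 ≤ e := arcIntegral_nonneg fun u => by positivity
  have hD0 : 0 ≤ D := arcIntegral_nonneg fun u => by positivity
  have hH0 : 0 ≤ H := arcIntegral_nonneg fun u => by positivity
  -- Integrations by parts.
  have hDfb : D + arcIntegral c (fun u => f u * b u) = 0 := by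
    rw [hD_def, ← arcIntegral_add hv (by fun_prop) (by fun_prop)]
    refine hc.arcIntegral_eq_zero (hf.mul ha).periodic (by fun_prop) fun u => ?_
    exact ((hfa u).fun_mul (hab u)).congr_deriv (by ring)
  have hD2 : D ^ 2 ≤ e * S := by
    have := arcIntegral_mul_sq_le hv hfc hb
    rwa [show arcIntegral c (fun u => f u * b u) = -D by linarith, neg_sq] at this
  have hH : H = S - 5 / 2 * D + 25 / 16 * e := by
    rw [hH_def, show (fun u => (b u + 5 / 4 * f u) ^ 2)
      = fun u => b u ^ 2 + 5 / 2 * (f u * b u) + 25 / 16 * f u ^ 2 by funext u; ring,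
      arcIntegral_add hv (by fun_prop) (by fun_prop),
      arcIntegral_add hv (by fun_prop) (by fun_prop), arcIntegral_const_mul,
      arcIntegral_const_mul]
    linarith
  have hS : S ≤ 2 * H + 25 / 8 * e := by
    refine arcIntegral_le_add hv (by fun_prop) (by fun_prop) (by fun_prop) fun u _ => ?_
    linarith [sq_nonneg (b u + 5 / 2 * f u)]
  -- Pointwise bounds.
  have hM : ∀ u ∈ Set.Icc 0 (2 * Real.pi), f u ^ 2 ≤ 2 * e + D :=
    fun u hu => hc.sq_le_arcIntegral hL hfc hac hfa hu
  have hN : ∀ u ∈ Set.Icc 0 (2 * Real.pi), a u ^ 2 ≤ 2 * D + S :=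
    fun u hu => hc.sq_le_arcIntegral hL hac hb hab hu
  have hA₄le : A₄ ≤ (2 * e + D) * e := by
    have := arcIntegral_sq_mul_le hv hfc hfc hM
    simpa only [← pow_add] using this
  have ha4le : arcIntegral c (fun u => a u ^ 4) ≤ (2 * D + S) * D := by
    have := arcIntegral_sq_mul_le hv hac hac hN
    simpa only [← pow_add] using this
  have hQle : Q ≤ (2 * e + D) * D := arcIntegral_sq_mul_le hv hfc hac hM
  have hA₃le : A₃ ≤ 1 / 2 * e + 1 / 2 * A₄ :=
    arcIntegral_le_add hv (by fun_prop) (by fun_prop) (by fun_prop) fun u _ => by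
      linarith [mul_nonneg (sq_nonneg (f u)) (sq_nonneg (f u - 1))]
  have hquart : A₅ * (-6) ≤ 14 * A₄ + 1 * A₆ := by
    rw [mul_comm, hA₅, ← arcIntegral_const_mul]
    exact arcIntegral_le_add hv (by fun_prop) (by fun_prop) (by fun_prop) fun u _ => by
      linarith [mul_nonneg (sq_nonneg (f u ^ 2)) (sq_nonneg (f u + 3)), sq_nonneg (f u ^ 2)]
  -- The two bounds for the cubic terms.
  have hK₂ : 24 * P - 16 * A₃ ≤ 24 * √(2 * e + D) * D + 16 * √(2 * e + D) * e := by
    set m := √(2 * e + D)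
    have hm : ∀ u ∈ Set.Icc 0 (2 * Real.pi), |f u| ≤ m := fun u hu => Real.abs_le_sqrt (hM u hu)
    rw [hP, hA₃, ← arcIntegral_const_mul, ← arcIntegral_const_mul,
      ← arcIntegral_sub hv (by fun_prop) (by fun_prop)]
    refine arcIntegral_le_add hv (by fun_prop) (by fun_prop) (by fun_prop) fun u hu => ?_
    obtain ⟨h1, h2⟩ := abs_le.1 (hm u hu)
    linarith [mul_le_mul_of_nonneg_right h2 (sq_nonneg (a u)),
      mul_le_mul_of_nonneg_right h1 (sq_nonneg (f u))]
  have hK₁ : 24 * P - 16 * A₃ ≤ 2 * H + 41 * (2 * e + D) * e + (2 * D + S) * D := by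
    have h5 : 24 * P - 16 * A₃ ≤ 2 * H + 41 * A₄ + arcIntegral c (fun u => a u ^ 4) :=
      hc.cubic_le hf ha hb hfa hab
    linarith
  have hE2 : arcIntegral c (fun u => (1 + f u) ^ 2) = L + e :=
    arcIntegral_one_add_sq hv hfc hmean
  have hE4 : arcIntegral c (fun u => (1 + f u) ^ 4) = L + 6 * e + 4 * A₃ + A₄ :=
    arcIntegral_one_add_pow_four hv hfc hmean
  have hF : arcIntegral c (fun u => (2 * b u + (1 + f u) ^ 3) ^ 2)
      = 4 * S + (L + 15 * e + 20 * A₃ + 15 * A₄ + 6 * A₅ + A₆) - 12 * (D + 2 * P + Q) :=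
    hc.arcIntegral_gradient_sq hf ha hb hfa hab hmean
  -- The nonlocal factor.
  have hL0 : 0 < L := by linarith
  set x := L⁻¹
  have hx0 : 0 ≤ x := inv_nonneg.2 hL0.le
  have hx1 : x ≤ 1 := inv_le_one_of_one_le₀ hL
  have hxL : x * L = 1 := inv_mul_cancel₀ hL0.ne'
  have hR : 12 * Q - (14 * A₄ + 6 * A₅ + A₆) - x * e * (2 * D - 6 * e - 4 * A₃ - A₄)
      ≤ 12 * (2 * e + D) * D + 8 * e ^ 2 + 3 * (2 * e + D) * e ^ 2 := by
    have h1 : x * e * (6 * e + 4 * A₃ + A₄) ≤ x * e * (8 * e + 3 * ((2 * e + D) * e)) :=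
      mul_le_mul_of_nonneg_left (by linarith) (mul_nonneg hx0 he0)
    have h2 : x * (e * (8 * e + 3 * ((2 * e + D) * e)))
        ≤ 1 * (e * (8 * e + 3 * ((2 * e + D) * e))) :=
      mul_le_mul_of_nonneg_right hx1 (by positivity)
    have h3 : 0 ≤ x * e * (2 * D) := by positivity
    linarith
  have key := dissipation_arith he0 he hD0 hD2 hH0 hH hS (Real.sqrt_nonneg _)
    (Real.sq_sqrt (by positivity)) hK₁ hK₂ hR
  rw [hE2, hE4, hF]
  refine le_of_eq_of_le ?_ key
  linear_combination (L + 7 * e + 4 * A₃ + A₄ - 2 * D) * hxL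

/-! ### Smooth families on a time interval that is closed at its initial time -/

section TimeInterval

variable {T : EReal}

theorem zero_mem_timeInterval (hT : 0 < T) : (0 : ℝ) ∈ timeInterval T := ⟨le_rfl, hT⟩

theorem mem_timeInterval_of_le {s t : ℝ} (ht : t ∈ timeInterval T) (hs : 0 ≤ s) (hst : s ≤ t) :
    s ∈ timeInterval T :=
  ⟨hs, (EReal.coe_le_coe_iff.2 hst).trans_lt ht.2⟩

theorem exists_gt_mem_timeInterval {t : ℝ} (ht : t ∈ timeInterval T) :
    ∃ b ∈ timeInterval T, t < b := by
  obtain ⟨b, hb, hb'⟩ := EReal.lt_iff_exists_real_btwn.1 ht.2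
  have hb := EReal.coe_lt_coe_iff.1 hb
  exact ⟨b, ⟨ht.1.trans hb.le, hb'⟩, hb⟩

theorem ordConnected_timeInterval : (timeInterval T).OrdConnected :=
  ⟨fun _ hx _ hy _ hz => mem_timeInterval_of_le hy (hx.1.trans hz.1) hz.2⟩

theorem convex_timeInterval : Convex ℝ (timeInterval T) :=
  ordConnected_timeInterval.convex

theorem interior_timeInterval_nonempty (hT : 0 < T) : (interior (timeInterval T)).Nonempty := by
  obtain ⟨b, hb, hb0⟩ := exists_gt_mem_timeInterval (zero_mem_timeInterval hT)
  refine ⟨b / 2, mem_interior.2 ⟨Set.Ioo 0 b, fun x hx =>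
    mem_timeInterval_of_le hb hx.1.le hx.2.le, isOpen_Ioo, ?_⟩⟩
  constructor <;> linarith

theorem uniqueDiffOn_timeInterval (hT : 0 < T) : UniqueDiffOn ℝ (timeInterval T) :=
  uniqueDiffOn_convex convex_timeInterval (interior_timeInterval_nonempty hT)

theorem timeInterval_mem_nhdsGE {t : ℝ} (ht : t ∈ timeInterval T) :
    timeInterval T ∈ nhdsWithin t (Set.Ici t) := by
  obtain ⟨b, hb, htb⟩ := exists_gt_mem_timeInterval ht
  exact Filter.mem_of_superset (Icc_mem_nhdsGE htb)
    fun s hs => mem_timeInterval_of_le hb (ht.1.trans hs.1) hs.2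

theorem convex_timeDomain : Convex ℝ (timeInterval T ×ˢ (Set.univ : Set ℝ)) :=
  convex_timeInterval.prod convex_univ

theorem interior_timeDomain_nonempty (hT : 0 < T) :
    (interior (timeInterval T ×ˢ (Set.univ : Set ℝ))).Nonempty := by
  rw [interior_prod_eq, interior_univ]
  exact (interior_timeInterval_nonempty hT).prod Set.univ_nonempty

theorem uniqueDiffOn_timeDomain (hT : 0 < T) :
    UniqueDiffOn ℝ (timeInterval T ×ˢ (Set.univ : Set ℝ)) :=
  uniqueDiffOn_convex convex_timeDomain (interior_timeDomain_nonempty hT)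

end TimeInterval

variable {T : EReal} {E : Type*} [NormedAddCommGroup E] [NormedSpace ℝ E]

/-- A function `g t u` that is smooth on `[0, T) × ℝ`, up to the boundary `t = 0`. -/
def IsSmoothFamily (T : EReal) (g : ℝ → ℝ → E) : Prop :=
  ContDiffOn ℝ ∞ (fun p : ℝ × ℝ => g p.1 p.2) (timeInterval T ×ˢ Set.univ)

/-- The time derivative of a family, one-sided at `t = 0`. -/
noncomputable def timeDeriv (T : EReal) (g : ℝ → ℝ → E) (t u : ℝ) : E :=
  derivWithin (fun τ => g τ u) (timeInterval T) t

theorem hasDerivAt_slice {G : ℝ × ℝ → E}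
    (hG : DifferentiableOn ℝ G (timeInterval T ×ˢ Set.univ)) {t : ℝ} (ht : t ∈ timeInterval T)
    (u : ℝ) :
    HasDerivAt (fun x => G (t, x))
      (fderivWithin ℝ G (timeInterval T ×ˢ Set.univ) (t, u) (0, 1)) u := by
  have h1 : HasDerivWithinAt (fun x : ℝ => (t, x)) ((0 : ℝ), (1 : ℝ)) Set.univ u :=
    ((hasDerivAt_const u t).prodMk (hasDerivAt_id u)).hasDerivWithinAt
  rw [← hasDerivWithinAt_univ]
  exact (hG (t, u) ⟨ht, Set.mem_univ _⟩).hasFDerivWithinAt.comp_hasDerivWithinAt u h1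
    (t := timeInterval T ×ˢ Set.univ) fun x _ => ⟨ht, Set.mem_univ _⟩

theorem hasDerivWithinAt_slice {G : ℝ × ℝ → E}
    (hG : DifferentiableOn ℝ G (timeInterval T ×ˢ Set.univ)) {t : ℝ} (ht : t ∈ timeInterval T)
    (u : ℝ) :
    HasDerivWithinAt (fun τ => G (τ, u))
      (fderivWithin ℝ G (timeInterval T ×ˢ Set.univ) (t, u) (1, 0)) (timeInterval T) t := by
  have h1 : HasDerivWithinAt (fun τ : ℝ => (τ, u)) ((1 : ℝ), (0 : ℝ)) (timeInterval T) t :=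
    ((hasDerivAt_id t).prodMk (hasDerivAt_const t u)).hasDerivWithinAt
  exact (hG (t, u) ⟨ht, Set.mem_univ _⟩).hasFDerivWithinAt.comp_hasDerivWithinAt t h1
    (t := timeInterval T ×ˢ Set.univ) fun x hx => ⟨hx, Set.mem_univ _⟩

namespace IsSmoothFamily

variable {g : ℝ → ℝ → E}

theorem contDiff (hg : IsSmoothFamily T g) {t : ℝ} (ht : t ∈ timeInterval T) :
    ContDiff ℝ ∞ (g t) := by
  exact ContDiffOn.comp_contDiff (f := fun x : ℝ => (t, x)) hg (by fun_prop)
    fun x => ⟨ht, Set.mem_univ _⟩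

theorem hasDerivWithinAt (hT : 0 < T) (hg : IsSmoothFamily T g) {t : ℝ}
    (ht : t ∈ timeInterval T) (u : ℝ) :
    HasDerivWithinAt (fun τ => g τ u) (timeDeriv T g t u) (timeInterval T) t := by
  have h := hasDerivWithinAt_slice (hg.differentiableOn (by simp)) ht u
  have h1 := h.derivWithin (uniqueDiffOn_timeInterval hT t ht)
  rwa [← h1] at h

theorem timeDeriv_eq (hT : 0 < T) {t u : ℝ} (ht : t ∈ timeInterval T) {x : E}
    (h : HasDerivWithinAt (fun τ => g τ u) x (timeInterval T) t) : timeDeriv T g t u = x :=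
  h.derivWithin (uniqueDiffOn_timeInterval hT t ht)

theorem fderivWithin_apply (hT : 0 < T) (hg : IsSmoothFamily T g) (w : ℝ × ℝ) :
    ContDiffOn ℝ ∞ (fun p => fderivWithin ℝ (fun p : ℝ × ℝ => g p.1 p.2)
      (timeInterval T ×ˢ Set.univ) p w) (timeInterval T ×ˢ Set.univ) :=
  (ContDiffOn.fderivWithin hg (uniqueDiffOn_timeDomain hT) (by simp)).clm_apply contDiffOn_const

theorem deriv (hT : 0 < T) (hg : IsSmoothFamily T g) : IsSmoothFamily T (fun t => deriv (g t)) :=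
  (hg.fderivWithin_apply hT (0, 1)).congr fun p hp =>
    (hasDerivAt_slice (hg.differentiableOn (by simp)) hp.1 p.2).deriv

theorem timeDeriv (hT : 0 < T) (hg : IsSmoothFamily T g) : IsSmoothFamily T (timeDeriv T g) :=
  (hg.fderivWithin_apply hT (1, 0)).congr fun _ hp =>
    timeDeriv_eq hT hp.1 (hasDerivWithinAt_slice (hg.differentiableOn (by simp)) hp.1 _)

/-- Time and space derivatives commute, up to the boundary `t = 0`. -/
theorem hasDerivWithinAt_deriv (hT : 0 < T) (hg : IsSmoothFamily T g) {t : ℝ}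
    (ht : t ∈ timeInterval T) (u : ℝ) :
    HasDerivWithinAt (fun τ => _root_.deriv (g τ) u)
      (_root_.deriv (ElasticFlow.timeDeriv T g t) u) (timeInterval T) t := by
  set S := timeInterval T ×ˢ (Set.univ : Set ℝ)
  set G := fun p : ℝ × ℝ => g p.1 p.2
  have hGd : DifferentiableOn ℝ G S := hg.differentiableOn (by simp)
  have hG' : DifferentiableOn ℝ (fderivWithin ℝ G S) S :=
    (ContDiffOn.fderivWithin hg (uniqueDiffOn_timeDomain hT) (m := ∞)
      (by simp)).differentiableOn (by simp)
  have hmem : (t, u) ∈ S := ⟨ht, Set.mem_univ _⟩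
  have h1 : HasDerivWithinAt (fun τ => fderivWithin ℝ G S (τ, u) (0, 1))
      (fderivWithin ℝ (fderivWithin ℝ G S) S (t, u) (1, 0) (0, 1)) (timeInterval T) t :=
    (ContinuousLinearMap.apply ℝ E ((0 : ℝ), (1 : ℝ))).hasFDerivAt.comp_hasDerivWithinAt t
      (hasDerivWithinAt_slice hG' ht u)
  have h2 : HasDerivAt (fun x => fderivWithin ℝ G S (t, x) (1, 0))
      (fderivWithin ℝ (fderivWithin ℝ G S) S (t, u) (0, 1) (1, 0)) u :=
    (ContinuousLinearMap.apply ℝ E ((1 : ℝ), (0 : ℝ))).hasFDerivAt.comp_hasDerivAt u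
      (hasDerivAt_slice hG' ht u)
  have hsymm : IsSymmSndFDerivWithinAt ℝ G S (t, u) :=
    (hg (t, u) hmem).isSymmSndFDerivWithinAt (n := ∞)
      (by simpa using ENat.LEInfty.out) (uniqueDiffOn_timeDomain hT)
      (by
        rw [convex_timeDomain.closure_interior_eq_closure_of_nonempty_interior
          (interior_timeDomain_nonempty hT)]
        exact subset_closure hmem) hmem
  have h3 : (fun x => fderivWithin ℝ G S (t, x) (1, 0)) = ElasticFlow.timeDeriv T g t :=
    funext fun x => (timeDeriv_eq hT ht (hasDerivWithinAt_slice hGd ht x)).symm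
  rw [h3] at h2
  rw [h2.deriv, hsymm.eq]
  exact h1.congr (fun τ hτ => (hasDerivAt_slice hGd hτ u).deriv)
    (hasDerivAt_slice hGd ht u).deriv

/-- Differentiation under the integral sign, up to the boundary `t = 0`. -/
theorem hasDerivWithinAt_integral [CompleteSpace E] (hT : 0 < T) (hg : IsSmoothFamily T g)
    {t : ℝ} (ht : t ∈ timeInterval T) {g' : ℝ → E}
    (hg' : ∀ u, HasDerivWithinAt (fun τ => g τ u) (g' u) (timeInterval T) t) (a b : ℝ) :
    HasDerivWithinAt (fun τ => ∫ u in a..b, g τ u) (∫ u in a..b, g' u) (timeInterval T) t := by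
  rw [show g' = ElasticFlow.timeDeriv T g t from
    funext fun u => (timeDeriv_eq hT ht (hg' u)).symm]
  obtain ⟨r, hr, htr⟩ := exists_gt_mem_timeInterval ht
  have hr0 : 0 ≤ r := ht.1.trans htr.le
  -- Extend the time derivative continuously from `[0, r]` to all times by clamping.
  set h : ℝ → ℝ → E := fun τ u => ElasticFlow.timeDeriv T g (max 0 (min r τ)) u with hh
  have hclamp : ∀ τ : ℝ, max 0 (min r τ) ∈ timeInterval T := fun τ =>
    mem_timeInterval_of_le hr (le_max_left _ _) (max_le hr0 (min_le_left _ _))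
  have hh_eq : ∀ τ ∈ Set.Icc 0 r, ∀ u, h τ u = ElasticFlow.timeDeriv T g τ u := fun τ hτ u => by
    simp only [hh, min_eq_right hτ.2, max_eq_right hτ.1]
  have hcont : Continuous fun p : ℝ × ℝ => h p.1 p.2 :=
    (hg.timeDeriv hT).continuousOn.comp_continuous
      (f := fun p : ℝ × ℝ => (max 0 (min r p.1), p.2)) (by fun_prop)
      fun p => ⟨hclamp p.1, Set.mem_univ _⟩
  have hftc : ∀ τ ∈ Set.Icc 0 r, ∀ u, g τ u = g 0 u + ∫ s in (0 : ℝ)..τ, h s u := by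
    intro τ hτ u
    have hsub : ∀ s ∈ Set.Icc 0 τ, s ∈ timeInterval T := fun s hs =>
      mem_timeInterval_of_le hr hs.1 (hs.2.trans hτ.2)
    rw [intervalIntegral.integral_eq_sub_of_hasDeriv_right (f := fun s => g s u)]
    · abel
    · rw [Set.uIcc_of_le hτ.1]
      exact fun s hs => (hg.hasDerivWithinAt hT (hsub s hs) u).continuousWithinAt.mono hsub
    · rw [min_eq_left hτ.1, max_eq_right hτ.1]
      intro s hs
      have hs' := hsub s ⟨hs.1.le, hs.2.le⟩
      rw [hh_eq s ⟨hs.1.le, hs.2.le.trans hτ.2⟩]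
      exact (hg.hasDerivWithinAt hT hs' u).mono_of_mem_nhdsWithin
        (nhdsWithin_mono _ Set.Ioi_subset_Ici_self (timeInterval_mem_nhdsGE hs'))
    · exact Continuous.intervalIntegrable
        (hcont.comp (by fun_prop : Continuous fun s : ℝ => (s, u))) _ _
  have hJ : Continuous fun s => ∫ u in a..b, h s u :=
    intervalIntegral.continuous_parametric_intervalIntegral_of_continuous' hcont a b
  have hfub : ∀ τ ∈ Set.Icc 0 r, ∫ u in a..b, g τ u
      = (∫ u in a..b, g 0 u) + ∫ s in (0 : ℝ)..τ, ∫ u in a..b, h s u := by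
    intro τ hτ
    have hswap : ∫ s in (0 : ℝ)..τ, ∫ u in a..b, h s u
        = ∫ u in a..b, ∫ s in (0 : ℝ)..τ, h s u := by
      refine MeasureTheory.intervalIntegral_intervalIntegral_swap ?_
      exact (hcont.continuousOn.integrableOn_compact
        (isCompact_uIcc.prod isCompact_uIcc)).mono_set
        (Set.prod_mono Set.uIoc_subset_uIcc Set.uIoc_subset_uIcc)
    have hin : Continuous fun u => ∫ s in (0 : ℝ)..τ, h s u :=
      intervalIntegral.continuous_parametric_intervalIntegral_of_continuous'
        (f := fun u s => h s u) (hcont.comp continuous_swap) 0 τ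
    rw [hswap, ← intervalIntegral.integral_add
      ((hg.contDiff (zero_mem_timeInterval hT)).continuous.intervalIntegrable _ _)
      (hin.intervalIntegrable _ _)]
    exact intervalIntegral.integral_congr fun u _ => hftc τ hτ u
  have hder : HasDerivAt (fun τ => (∫ u in a..b, g 0 u) + ∫ s in (0 : ℝ)..τ, ∫ u in a..b, h s u)
      (∫ u in a..b, h t u) t :=
    (hJ.integral_hasStrictDerivAt 0 t).hasDerivAt.const_add _
  have htmem : t ∈ Set.Icc 0 r := ⟨ht.1, htr.le⟩
  simp only [hh_eq t htmem] at hder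
  refine hder.hasDerivWithinAt.congr_of_eventuallyEq ?_ (hfub t htmem)
  filter_upwards [self_mem_nhdsWithin, mem_nhdsWithin_of_mem_nhds (Iio_mem_nhds htr)] with τ hτ hτr
  exact hfub τ ⟨hτ.1, le_of_lt hτr⟩

end IsSmoothFamily

/-! ### First variation formulas for normal flows

The hypotheses below say that at the time `t` the curve moves with normal velocity `V`; the
functions `V'` and `V''` are the arclength derivatives `V_s` and `V_ss`. -/

section Variation

variable {T : EReal} {γ : ℝ → ℝ → ℂ}

theorem isSmoothFamily_speed (hT : 0 < T) (hγ : IsSmoothFamily T γ)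
    (hc : ∀ t ∈ timeInterval T, IsClosedImmersion (γ t)) :
    IsSmoothFamily T (fun t => speed (γ t)) :=
  ContDiffOn.norm ℝ (hγ.deriv hT) fun p hp => (hc p.1 hp.1).immersed p.2

theorem isSmoothFamily_arcDeriv {E : Type*} [NormedAddCommGroup E] [NormedSpace ℝ E]
    (hT : 0 < T) (hγ : IsSmoothFamily T γ)
    (hc : ∀ t ∈ timeInterval T, IsClosedImmersion (γ t)) {g : ℝ → ℝ → E}
    (hg : IsSmoothFamily T g) : IsSmoothFamily T (fun t => arcDeriv (γ t) (g t)) :=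
  ContDiffOn.smul (ContDiffOn.inv (isSmoothFamily_speed hT hγ hc)
    fun p hp => ((hc p.1 hp.1).speed_pos p.2).ne') (hg.deriv hT)

theorem isSmoothFamily_tangent (hT : 0 < T) (hγ : IsSmoothFamily T γ)
    (hc : ∀ t ∈ timeInterval T, IsClosedImmersion (γ t)) :
    IsSmoothFamily T (fun t => tangent (γ t)) :=
  isSmoothFamily_arcDeriv hT hγ hc hγ

theorem isSmoothFamily_curvature (hT : 0 < T) (hγ : IsSmoothFamily T γ)
    (hc : ∀ t ∈ timeInterval T, IsClosedImmersion (γ t)) :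
    IsSmoothFamily T (fun t => curvature (γ t)) :=
  ContDiffOn.inner ℝ (isSmoothFamily_arcDeriv hT hγ hc (isSmoothFamily_tangent hT hγ hc))
    (contDiffOn_const.mul (isSmoothFamily_tangent hT hγ hc))

variable {t : ℝ} {V V' V'' : ℝ → ℝ}

theorem hasDerivWithinAt_deriv_curve (hT : 0 < T) (hγ : IsSmoothFamily T γ)
    (hc : IsClosedImmersion (γ t)) (ht : t ∈ timeInterval T)
    (hV : ∀ u, HasDerivAt V (speed (γ t) u * V' u) u)
    (hVt : ∀ u, timeDeriv T γ t u = V u • normal (γ t) u) (u : ℝ) :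
    HasDerivWithinAt (fun τ => deriv (γ τ) u)
      (speed (γ t) u • (V' u • normal (γ t) u
        - (V u * curvature (γ t) u) • tangent (γ t) u)) (timeInterval T) t := by
  refine (hγ.hasDerivWithinAt_deriv hT ht u).congr_deriv ?_
  rw [show timeDeriv T γ t = fun u => V u • normal (γ t) u from funext hVt,
    ((hV u).fun_smul (hc.hasDerivAt_normal u)).deriv]
  module

theorem hasDerivWithinAt_speed (hT : 0 < T) (hγ : IsSmoothFamily T γ)
    (hc : IsClosedImmersion (γ t)) (ht : t ∈ timeInterval T)
    (hV : ∀ u, HasDerivAt V (speed (γ t) u * V' u) u)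
    (hVt : ∀ u, timeDeriv T γ t u = V u • normal (γ t) u) (u : ℝ) :
    HasDerivWithinAt (fun τ => speed (γ τ) u)
      (-(curvature (γ t) u * V u * speed (γ t) u)) (timeInterval T) t := by
  have hv := hc.speed_pos u
  have h := (hasDerivWithinAt_deriv_curve hT hγ hc ht hV hVt u).norm_sq.sqrt
    (pow_ne_zero 2 (norm_ne_zero_iff.2 (hc.immersed u)))
  simp only [Real.sqrt_sq (norm_nonneg _)] at h
  refine h.congr_deriv ?_
  rw [(hc.hasDerivAt_self u).deriv, inner_smul_left, inner_smul_right, inner_sub_right,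
    inner_smul_right, inner_smul_right, inner_tangent_normal, hc.inner_tangent_tangent, norm_smul,
    hc.norm_tangent, Real.norm_of_nonneg hv.le]
  simp only [conj_trivial]
  field_simp
  ring

theorem hasDerivWithinAt_tangent (hT : 0 < T) (hγ : IsSmoothFamily T γ)
    (hc : IsClosedImmersion (γ t)) (ht : t ∈ timeInterval T)
    (hV : ∀ u, HasDerivAt V (speed (γ t) u * V' u) u)
    (hVt : ∀ u, timeDeriv T γ t u = V u • normal (γ t) u) (u : ℝ) :
    HasDerivWithinAt (fun τ => tangent (γ τ) u) (V' u • normal (γ t) u) (timeInterval T) t := by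
  have hv := (hc.speed_pos u).ne'
  refine (((hasDerivWithinAt_speed hT hγ hc ht hV hVt u).fun_inv hv).fun_smul
    (hasDerivWithinAt_deriv_curve hT hγ hc ht hV hVt u)).congr_deriv ?_
  rw [(hc.hasDerivAt_self u).deriv, smul_smul, smul_smul, inv_mul_cancel₀ hv, one_smul,
    show -(-(curvature (γ t) u * V u * speed (γ t) u)) / speed (γ t) u ^ 2 * speed (γ t) u
      = V u * curvature (γ t) u by field_simp]
  abel

theorem hasDerivWithinAt_normal (hT : 0 < T) (hγ : IsSmoothFamily T γ)
    (hc : IsClosedImmersion (γ t)) (ht : t ∈ timeInterval T)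
    (hV : ∀ u, HasDerivAt V (speed (γ t) u * V' u) u)
    (hVt : ∀ u, timeDeriv T γ t u = V u • normal (γ t) u) (u : ℝ) :
    HasDerivWithinAt (fun τ => normal (γ τ) u) (-V' u • tangent (γ t) u) (timeInterval T) t := by
  refine ((hasDerivWithinAt_tangent hT hγ hc ht hV hVt u).const_mul Complex.I).congr_deriv ?_
  simp only [normal, Complex.real_smul]
  push_cast
  linear_combination (V' u * tangent (γ t) u : ℂ) * Complex.I_mul_I

/-- Evolution of the curvature density: `∂ₜ(k ds) = V_ss ds`. -/
theorem hasDerivWithinAt_curvature_mul_speed (hT : 0 < T) (hγ : IsSmoothFamily T γ)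
    (hc : ∀ t ∈ timeInterval T, IsClosedImmersion (γ t)) (ht : t ∈ timeInterval T)
    (hV : ∀ u, HasDerivAt V (speed (γ t) u * V' u) u)
    (hV' : ∀ u, HasDerivAt V' (speed (γ t) u * V'' u) u)
    (hVt : ∀ u, timeDeriv T γ t u = V u • normal (γ t) u) (u : ℝ) :
    HasDerivWithinAt (fun τ => curvature (γ τ) u * speed (γ τ) u)
      (V'' u * speed (γ t) u) (timeInterval T) t := by
  have hct := hc t ht
  have htan : timeDeriv T (fun τ => tangent (γ τ)) t = fun u => V' u • normal (γ t) u :=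
    funext fun u => IsSmoothFamily.timeDeriv_eq hT ht
      (hasDerivWithinAt_tangent hT hγ hct ht hV hVt u)
  have h1 := (isSmoothFamily_tangent hT hγ hc).hasDerivWithinAt_deriv hT ht u
  rw [htan, ((hV' u).fun_smul (hct.hasDerivAt_normal u)).deriv] at h1
  have h2 := h1.inner ℝ (hasDerivWithinAt_normal hT hγ hct ht hV hVt u)
  have hk : ∀ τ ∈ timeInterval T, curvature (γ τ) u * speed (γ τ) u
      = inner ℝ (deriv (tangent (γ τ)) u) (normal (γ τ) u) := fun τ hτ => by
    rw [((hc τ hτ).hasDerivAt_tangent u).deriv, inner_smul_left, inner_normal_normal (hc τ hτ)]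
    simp [mul_comm]
  refine (h2.congr hk (hk t ht)).congr_deriv ?_
  rw [(hct.hasDerivAt_tangent u).deriv, inner_add_left, inner_smul_left, inner_smul_left,
    inner_smul_left, inner_smul_left, inner_smul_right, inner_normal_normal hct,
    inner_tangent_normal, real_inner_comm, inner_tangent_normal]
  simp [mul_comm]

/-- Evolution of the density of the excess:
`∂ₜ((k - 1)² ds) = (2 k V_ss + k³ V - 2 V_ss - k V) ds`. -/
theorem hasDerivWithinAt_excess_density (hT : 0 < T) (hγ : IsSmoothFamily T γ)
    (hc : ∀ t ∈ timeInterval T, IsClosedImmersion (γ t)) (ht : t ∈ timeInterval T)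
    (hV : ∀ u, HasDerivAt V (speed (γ t) u * V' u) u)
    (hV' : ∀ u, HasDerivAt V' (speed (γ t) u * V'' u) u)
    (hVt : ∀ u, timeDeriv T γ t u = V u • normal (γ t) u) (u : ℝ) :
    HasDerivWithinAt (fun τ => (curvature (γ τ) u - 1) ^ 2 * speed (γ τ) u)
      ((2 * (curvature (γ t) u * V'' u) + curvature (γ t) u ^ 3 * V u - 2 * V'' u
        - curvature (γ t) u * V u) * speed (γ t) u) (timeInterval T) t := by
  have hv := ((hc t ht).speed_pos u).ne'
  have hs := hasDerivWithinAt_speed hT hγ (hc t ht) ht hV hVt u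
  have hk := hasDerivWithinAt_curvature_mul_speed hT hγ hc ht hV hV' hVt u
  have h := (((hk.fun_pow 2).fun_div hs hv).fun_sub (hk.const_mul 2)).fun_add hs
  have heq : ∀ τ ∈ timeInterval T, (curvature (γ τ) u - 1) ^ 2 * speed (γ τ) u
      = (curvature (γ τ) u * speed (γ τ) u) ^ 2 / speed (γ τ) u
        - 2 * (curvature (γ τ) u * speed (γ τ) u) + speed (γ τ) u := fun τ hτ => by
    have := ((hc τ hτ).speed_pos u).ne'
    field_simp
    ring
  refine (h.congr heq (heq t ht)).congr_deriv ?_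
  field_simp
  push_cast
  ring

/-- First variation of length: `L' = -∫ k V ds`. -/
theorem hasDerivWithinAt_length (hT : 0 < T) (hγ : IsSmoothFamily T γ)
    (hc : ∀ t ∈ timeInterval T, IsClosedImmersion (γ t)) (ht : t ∈ timeInterval T)
    (hV : ∀ u, HasDerivAt V (speed (γ t) u * V' u) u)
    (hVt : ∀ u, timeDeriv T γ t u = V u • normal (γ t) u) :
    HasDerivWithinAt (fun τ => length (γ τ))
      (-arcIntegral (γ t) (fun u => curvature (γ t) u * V u)) (timeInterval T) t := by
  have h := (isSmoothFamily_speed hT hγ hc).hasDerivWithinAt_integral hT ht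
    (hasDerivWithinAt_speed hT hγ (hc t ht) ht hV hVt) 0 (2 * Real.pi)
  rw [intervalIntegral.integral_neg] at h
  simpa only [length, arcIntegral, one_mul] using h

/-- The total curvature of a closed curve is invariant. -/
theorem hasDerivWithinAt_totalCurvature (hT : 0 < T) (hγ : IsSmoothFamily T γ)
    (hc : ∀ t ∈ timeInterval T, IsClosedImmersion (γ t)) (ht : t ∈ timeInterval T)
    (hV : ∀ u, HasDerivAt V (speed (γ t) u * V' u) u)
    (hV' : ∀ u, HasDerivAt V' (speed (γ t) u * V'' u) u)
    (hVp : Function.Periodic V' (2 * Real.pi)) (hV''c : Continuous V'')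
    (hVt : ∀ u, timeDeriv T γ t u = V u • normal (γ t) u) :
    HasDerivWithinAt (fun τ => arcIntegral (γ τ) (curvature (γ τ))) 0 (timeInterval T) t := by
  have h := IsSmoothFamily.hasDerivWithinAt_integral
    (g := fun τ u => curvature (γ τ) u * speed (γ τ) u) hT
    (ContDiffOn.mul (isSmoothFamily_curvature hT hγ hc) (isSmoothFamily_speed hT hγ hc))
    ht (hasDerivWithinAt_curvature_mul_speed hT hγ hc ht hV hV' hVt) 0 (2 * Real.pi)
  exact h.congr_deriv ((hc t ht).arcIntegral_eq_zero hVp hV''c hV')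

/-- First variation of the excess: `e' = ∫ (2 k_ss + k³) V ds - ∫ k V ds`. -/
theorem hasDerivWithinAt_curvatureExcess (hT : 0 < T) (hγ : IsSmoothFamily T γ)
    (hc : ∀ t ∈ timeInterval T, IsClosedImmersion (γ t)) (ht : t ∈ timeInterval T)
    (hV : ∀ u, HasDerivAt V (speed (γ t) u * V' u) u)
    (hV' : ∀ u, HasDerivAt V' (speed (γ t) u * V'' u) u)
    (hVs : IsSmoothPeriodic V) (hVs' : IsSmoothPeriodic V') (hV''c : Continuous V'')
    (hVt : ∀ u, timeDeriv T γ t u = V u • normal (γ t) u) :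
    HasDerivWithinAt (fun τ => curvatureExcess (γ τ))
      (arcIntegral (γ t) (fun u => (2 * curvatureSS (γ t) u + curvature (γ t) u ^ 3) * V u)
        - arcIntegral (γ t) (fun u => curvature (γ t) u * V u)) (timeInterval T) t := by
  have hct := hc t ht
  have hv := hct.continuous_speed
  have hk := hct.smooth_curvature.continuous
  have hkss := hct.smooth_curvatureSS.continuous
  have hVc := hVs.continuous
  have hks := hct.smooth_curvatureS.continuous
  have hVc' := hVs'.continuous
  have h := IsSmoothFamily.hasDerivWithinAt_integral
    (g := fun τ u => (curvature (γ τ) u - 1) ^ 2 * speed (γ τ) u) hT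
    (ContDiffOn.mul (ContDiffOn.pow
      (ContDiffOn.sub (isSmoothFamily_curvature hT hγ hc) contDiffOn_const) 2)
      (isSmoothFamily_speed hT hγ hc)) ht
    (hasDerivWithinAt_excess_density hT hγ hc ht hV hV' hVt) 0 (2 * Real.pi)
  refine h.congr_deriv ?_
  -- Two integrations by parts move the derivatives from `V` to `k`.
  have h0 : arcIntegral (γ t)
      (fun u => 2 * (curvature (γ t) u * V'' u - curvatureSS (γ t) u * V u) - 2 * V'' u) = 0 := by
    refine hct.arcIntegral_eq_zero
      (f := fun u => 2 * (curvature (γ t) u * V' u - curvatureS (γ t) u * V u) - 2 * V' u)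
      (((IsSmoothPeriodic.const (2 : ℝ)).mul ((hct.smooth_curvature.mul hVs').sub
        (hct.smooth_curvatureS.mul hVs))).sub
        ((IsSmoothPeriodic.const (2 : ℝ)).mul hVs')).periodic (by fun_prop) fun u => ?_
    refine (((((hct.hasDerivAt_curvature u).fun_mul (hV' u)).fun_sub
      ((hct.hasDerivAt_curvatureS u).fun_mul (hV u))).const_mul 2).fun_sub
      ((hV' u).const_mul 2)).congr_deriv ?_
    ring
  rw [← arcIntegral_sub hv (by fun_prop) (by fun_prop), ← add_zero (arcIntegral _ _), ← h0,
    ← arcIntegral_add hv (by fun_prop) (by fun_prop)]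
  simp only [arcIntegral]
  congr 1
  funext u
  ring

end Variation

/-! ### The rescaled free elastic flow -/

namespace IsRescaledFreeElasticFlow

variable {T : EReal} {γ : ℝ → ℝ → ℂ}

theorem isClosedImmersion (hγ : IsRescaledFreeElasticFlow T γ) {t : ℝ}
    (ht : t ∈ timeInterval T) : IsClosedImmersion (γ t) where
  contDiff := IsSmoothFamily.contDiff hγ.smooth ht
  periodic := hγ.closed t ht
  immersed := hγ.immersed t ht

/-- The first variation formulas along the flow: length and total curvature are constant, and
`e' = -∫ (2 k_ss + k³)² ds - λ ∫ k² ds`. -/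
theorem hasDerivWithinAt (hT : 0 < T) (hγ : IsRescaledFreeElasticFlow T γ) {t : ℝ}
    (ht : t ∈ timeInterval T) :
    HasDerivWithinAt (fun τ => length (γ τ)) 0 (timeInterval T) t ∧
    HasDerivWithinAt (fun τ => arcIntegral (γ τ) (curvature (γ τ))) 0 (timeInterval T) t ∧
    HasDerivWithinAt (fun τ => curvatureExcess (γ τ))
      (-arcIntegral (γ t) (fun u => (2 * curvatureSS (γ t) u + curvature (γ t) u ^ 3) ^ 2)
        - rescalingFactor (γ t) * arcIntegral (γ t) (fun u => curvature (γ t) u ^ 2))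
      (timeInterval T) t := by
  have hc := hγ.isClosedImmersion ht
  have hv := hc.continuous_speed
  have hk := hc.smooth_curvature.continuous
  have hkss := hc.smooth_curvatureSS.continuous
  have hp := (hc.inner hc.smooth_normal).continuous
  have hL := hc.length_pos.ne'
  set l := rescalingFactor (γ t) with hl
  have hlL : l * length (γ t) = 2 * arcIntegral (γ t) (fun u => curvatureS (γ t) u ^ 2)
      - arcIntegral (γ t) (fun u => curvature (γ t) u ^ 4) := by
    rw [hl, rescalingFactor]
    field_simp
  set V : ℝ → ℝ := fun u => -(2 * curvatureSS (γ t) u + curvature (γ t) u ^ 3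
    - l * inner ℝ (γ t u) (normal (γ t) u)) with hV
  have hVs : IsSmoothPeriodic V :=
    ((((IsSmoothPeriodic.const (2 : ℝ)).mul hc.smooth_curvatureSS).add
      (hc.smooth_curvature.pow 3)).sub
      ((IsSmoothPeriodic.const l).mul (hc.inner hc.smooth_normal))).neg
  have hVs' := hc.smooth_arcDeriv hVs
  have hVs'' := hc.smooth_arcDeriv hVs'
  have hVt : ∀ u, timeDeriv T γ t u = V u • normal (γ t) u := hγ.evolution t ht
  have hcs : ∀ t ∈ timeInterval T, IsClosedImmersion (γ t) := fun _ h => hγ.isClosedImmersion h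
  have hkV : arcIntegral (γ t) (fun u => curvature (γ t) u * V u) = 0 := by
    rw [show (fun u => curvature (γ t) u * V u) = fun u =>
        l * (curvature (γ t) u * inner ℝ (γ t u) (normal (γ t) u))
        - curvature (γ t) u * (2 * curvatureSS (γ t) u + curvature (γ t) u ^ 3) by
          funext u; simp only [hV]; ring,
      arcIntegral_sub hv (by fun_prop) (by fun_prop), arcIntegral_const_mul,
      hc.arcIntegral_curvature_mul_support, hc.arcIntegral_curvature_mul_gradient]
    linarith
  have hFV : arcIntegral (γ t)
      (fun u => (2 * curvatureSS (γ t) u + curvature (γ t) u ^ 3) * V u)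
      = -arcIntegral (γ t) (fun u => (2 * curvatureSS (γ t) u + curvature (γ t) u ^ 3) ^ 2)
        - l * arcIntegral (γ t) (fun u => curvature (γ t) u ^ 2) := by
    rw [show (fun u => (2 * curvatureSS (γ t) u + curvature (γ t) u ^ 3) * V u) = fun u =>
        l * ((2 * curvatureSS (γ t) u + curvature (γ t) u ^ 3)
          * inner ℝ (γ t u) (normal (γ t) u))
        - (2 * curvatureSS (γ t) u + curvature (γ t) u ^ 3) ^ 2 by
          funext u; simp only [hV]; ring,
      arcIntegral_sub hv (by fun_prop) (by fun_prop), arcIntegral_const_mul,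
      hc.arcIntegral_gradient_mul_support]
    ring
  refine ⟨?_, ?_, ?_⟩
  · have h := hasDerivWithinAt_length hT hγ.smooth hcs ht (hc.hasDerivAt hVs) hVt
    rwa [hkV, neg_zero] at h
  · exact hasDerivWithinAt_totalCurvature hT hγ.smooth hcs ht (hc.hasDerivAt hVs)
      (hc.hasDerivAt hVs') hVs'.periodic hVs''.continuous hVt
  · have h := hasDerivWithinAt_curvatureExcess hT hγ.smooth hcs ht (hc.hasDerivAt hVs)
      (hc.hasDerivAt hVs') hVs hVs' hVs''.continuous hVt
    rwa [hkV, hFV, sub_zero] at h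

end IsRescaledFreeElasticFlow

theorem eq_initial_of_hasDerivWithinAt_zero {T : EReal} (hT : 0 < T) {f : ℝ → ℝ}
    (hf : ∀ t ∈ timeInterval T, HasDerivWithinAt f 0 (timeInterval T) t) {t : ℝ}
    (ht : t ∈ timeInterval T) : f t = f 0 := by
  have h := convex_timeInterval.norm_image_sub_le_of_norm_hasDerivWithin_le (C := 0) hf
    (fun _ _ => by simp) (zero_mem_timeInterval hT) ht
  simpa [sub_eq_zero] using h

theorem kOsc_eq_of_meanCurvature_eq_one {c : ℝ → ℂ} (h : meanCurvature c = 1) :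
    kOsc c = length c * curvatureExcess c := by
  rw [kOsc, h, curvatureExcess]

/-- The dissipation inequality for the excess `e` of a closed curve with total curvature equal to
its length. -/
theorem IsClosedImmersion.excess_dissipation_le {c : ℝ → ℂ} (hc : IsClosedImmersion c)
    (hL : 1 ≤ length c) (hk : arcIntegral c (curvature c) = length c)
    (he : curvatureExcess c ≤ 1 / 40000) :
    -arcIntegral c (fun u => (2 * curvatureSS c u + curvature c u ^ 3) ^ 2)
        - rescalingFactor c * arcIntegral c (fun u => curvature c u ^ 2)
      ≤ -(7 / 4) * curvatureExcess c + 500 * curvatureExcess c ^ 2 := by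
  have hmean : arcIntegral c (fun u => curvature c u - 1) = 0 := by
    rw [arcIntegral_sub hc.continuous_speed hc.smooth_curvature.continuous continuous_const,
      arcIntegral_const, hk]
    ring
  have h := hc.dissipation_le hL (hc.smooth_curvature.sub (IsSmoothPeriodic.const 1))
    hc.smooth_curvatureS hc.smooth_curvatureSS.continuous
    (fun u => (hc.hasDerivAt_curvature u).sub_const 1) hc.hasDerivAt_curvatureS hmean he
  simp only [add_sub_cancel] at h
  exact h

/-! ### The differential inequality `e' ≤ -7/4 e + C e²` -/

/-- A nonnegative function that satisfies `e' ≤ -7/4 e + C e²` as long as it is at most `ε`, where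
`C ε ≤ 1/2`, and that starts below `ε`, stays below `ε`. -/
theorem le_of_small_differential_ineq {e e' : ℝ → ℝ} {b C ε : ℝ} (hε : 0 < ε) (hCε : C * ε ≤ 1 / 2)
    (hcont : ContinuousOn e (Set.Icc 0 b))
    (hder : ∀ s ∈ Set.Ico 0 b, HasDerivWithinAt e (e' s) (Set.Ici s) s)
    (hineq : ∀ s ∈ Set.Ico 0 b, e s ≤ ε → e' s ≤ -(7 / 4) * e s + C * e s ^ 2)
    (h0 : e 0 ≤ ε) : ∀ s ∈ Set.Icc 0 b, e s ≤ ε := by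
  refine image_le_of_deriv_right_lt_deriv_boundary' hcont hder (B := fun _ => ε)
    (B' := fun _ => 0) h0 continuousOn_const (fun _ _ => hasDerivWithinAt_const _ _ _) ?_
  intro s hs hes
  have := hineq s hs hes.le
  rw [hes] at this
  nlinarith

theorem le_initial_of_deriv_right_nonpos {w w' : ℝ → ℝ} {b : ℝ} (hb : 0 ≤ b)
    (hcont : ContinuousOn w (Set.Icc 0 b))
    (hder : ∀ s ∈ Set.Ico 0 b, HasDerivWithinAt w (w' s) (Set.Ici s) s)
    (hw : ∀ s ∈ Set.Ico 0 b, w' s ≤ 0) : w b ≤ w 0 :=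
  image_le_of_deriv_right_le_deriv_boundary (B := fun _ => w 0) (B' := fun _ => 0) hcont hder
    le_rfl continuousOn_const (fun _ _ => hasDerivWithinAt_const _ _ _) hw
    (Set.right_mem_Icc.2 hb)

/-- Decay for the differential inequality `e' ≤ -7/4 e + C e²` with small initial value. The
quadratic term first costs a part of the rate, `e ≤ e(0) exp(-t)`; it is then integrable in time,
so that the full rate holds with the factor `exp(1/2) ≤ 2`. -/
theorem decay_of_small_differential_ineq {e e' : ℝ → ℝ} {b C ε : ℝ} (hb : 0 ≤ b) (hC : 0 < C)
    (hε : 0 < ε) (hCε : C * ε ≤ 1 / 2) (hcont : ContinuousOn e (Set.Icc 0 b))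
    (hder : ∀ s ∈ Set.Ico 0 b, HasDerivWithinAt e (e' s) (Set.Ici s) s)
    (hpos : ∀ s ∈ Set.Icc 0 b, 0 ≤ e s)
    (hineq : ∀ s ∈ Set.Ico 0 b, e s ≤ ε → e' s ≤ -(7 / 4) * e s + C * e s ^ 2)
    (h0 : e 0 ≤ ε) : e b ≤ e 0 ∧ e b ≤ 2 * e 0 * Real.exp (-(7 / 4) * b) := by
  have hsmall := le_of_small_differential_ineq hε hCε hcont hder hineq h0
  have he' : ∀ s ∈ Set.Ico 0 b, e' s ≤ -e s := fun s hs => by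
    have h1 := hineq s hs (hsmall s ⟨hs.1, hs.2.le⟩)
    have h2 := hpos s ⟨hs.1, hs.2.le⟩
    have h3 := hsmall s ⟨hs.1, hs.2.le⟩
    have h4 : C * e s ≤ 1 / 2 := (mul_le_mul_of_nonneg_left h3 hC.le).trans hCε
    nlinarith
  have hmono : ∀ r ∈ Set.Icc 0 b, e r * Real.exp r ≤ e 0 := fun r hr => by
    have hd : ∀ s ∈ Set.Ico 0 r, HasDerivWithinAt (fun s => e s * Real.exp s)
        (e' s * Real.exp s + e s * Real.exp s) (Set.Ici s) s := fun s hs =>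
      (hder s ⟨hs.1, hs.2.trans_le hr.2⟩).fun_mul (Real.hasDerivAt_exp s).hasDerivWithinAt
    have := le_initial_of_deriv_right_nonpos hr.1
      ((hcont.mono (Set.Icc_subset_Icc_right hr.2)).mul Real.continuous_exp.continuousOn) hd
      fun s hs => by
        rw [← add_mul]
        exact mul_nonpos_of_nonpos_of_nonneg
          (by linarith [he' s ⟨hs.1, hs.2.trans_le hr.2⟩]) (Real.exp_pos _).le
    simpa using this
  have hexp : ∀ s ∈ Set.Icc 0 b, e s ≤ ε * Real.exp (-s) := fun s hs => by
    rw [Real.exp_neg, ← div_eq_mul_inv, le_div_iff₀ (Real.exp_pos s)]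
    exact (hmono s hs).trans h0
  have h00 := hpos 0 ⟨le_rfl, hb⟩
  refine ⟨?_, ?_⟩
  · have h1 := hmono b ⟨hb, le_rfl⟩
    have h2 := mul_le_mul_of_nonneg_left (Real.one_le_exp hb) (hpos b ⟨hb, le_rfl⟩)
    linarith
  · -- `e(s) exp(7s/4 + C ε exp(-s))` is nonincreasing.
    set φ : ℝ → ℝ := fun s => Real.exp (7 / 4 * s + C * ε * Real.exp (-s)) with hφ
    have hφd : ∀ s, HasDerivAt φ (φ s * (7 / 4 - C * ε * Real.exp (-s))) s := fun s => by
      have h1 : HasDerivAt (fun s : ℝ => Real.exp (-s)) (Real.exp (-s) * -1) s :=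
        (hasDerivAt_neg s).exp
      have h2 := (((hasDerivAt_id s).const_mul (7 / 4 : ℝ)).fun_add (h1.const_mul (C * ε))).exp
      exact h2.congr_deriv (by simp only [hφ, id]; ring)
    have hφc : Continuous φ := continuous_iff_continuousAt.2 fun s => (hφd s).continuousAt
    have h1 : e b * φ b ≤ e 0 * φ 0 := by
      refine le_initial_of_deriv_right_nonpos (w := fun s => e s * φ s) hb
        (hcont.mul hφc.continuousOn)
        (fun s hs => (hder s hs).fun_mul (hφd s).hasDerivWithinAt) fun s hs => ?_
      have hs' : s ∈ Set.Icc 0 b := ⟨hs.1, hs.2.le⟩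
      have ha := hineq s hs (hsmall s hs')
      have hb' : C * e s * e s ≤ C * (ε * Real.exp (-s)) * e s :=
        mul_le_mul_of_nonneg_right (mul_le_mul_of_nonneg_left (hexp s hs') hC.le) (hpos s hs')
      have hφ0 : 0 ≤ φ s := (Real.exp_pos _).le
      rw [show e' s * φ s + e s * (φ s * (7 / 4 - C * ε * Real.exp (-s)))
        = (e' s + e s * (7 / 4 - C * ε * Real.exp (-s))) * φ s by ring]
      exact mul_nonpos_of_nonpos_of_nonneg (by nlinarith) hφ0
    have h2 : φ 0 ≤ 2 := by
      have : φ 0 ≤ Real.exp (1 / 2) := by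
        simp only [hφ, mul_zero, neg_zero, Real.exp_zero, mul_one, zero_add]
        exact Real.exp_le_exp.2 hCε
      have h3 : Real.exp (1 / 2) * Real.exp (1 / 2) = Real.exp 1 := by
        rw [← Real.exp_add]; norm_num
      nlinarith [Real.exp_one_lt_d9, Real.exp_pos (1 / 2)]
    have h3 : Real.exp (7 / 4 * b) ≤ φ b :=
      Real.exp_le_exp.2 (le_add_of_nonneg_right (by positivity))
    have h4 : e b * Real.exp (7 / 4 * b) ≤ 2 * e 0 := by
      have ha := mul_le_mul_of_nonneg_left h3 (hpos b ⟨hb, le_rfl⟩)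
      have hb' := mul_le_mul_of_nonneg_left h2 h00
      linarith
    rw [neg_mul, Real.exp_neg, ← div_eq_mul_inv, le_div_iff₀ (Real.exp_pos _)]
    exact h4

end ElasticFlow

theorem corollary2p4 :
    ∃ ε₀ : ℝ, 0 < ε₀ ∧ ∃ C : ℝ, 0 < C ∧
      ∀ (ω : ℕ), 0 < ω → ∀ (T : EReal), 0 < T → ∀ γ : ℝ → ℝ → ℂ,
        ElasticFlow.IsRescaledFreeElasticFlow T γ →
        ElasticFlow.turningNumber (γ 0) = ω →
        ElasticFlow.length (γ 0) = 2 * Real.pi * ω →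
        ElasticFlow.curvatureExcess (γ 0) ≤ ε₀ →
        ∀ t ∈ ElasticFlow.timeInterval T,
          DifferentiableWithinAt ℝ (fun τ => ElasticFlow.curvatureExcess (γ τ))
            (ElasticFlow.timeInterval T) t ∧
          derivWithin (fun τ => ElasticFlow.curvatureExcess (γ τ))
              (ElasticFlow.timeInterval T) t ≤
            -(7 / 4) * ElasticFlow.curvatureExcess (γ t)
              + C * ElasticFlow.curvatureExcess (γ t) ^ 2 ∧
          ElasticFlow.curvatureExcess (γ t) ≤
            2 * ElasticFlow.curvatureExcess (γ 0) * Real.exp (-(7 / 4) * t) ∧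
          ElasticFlow.kOsc (γ t) ≤ ElasticFlow.kOsc (γ 0) ∧
          ElasticFlow.kOsc (γ t) ≤
            2 * ElasticFlow.kOsc (γ 0) * Real.exp (-(7 / 4) * t) := by
  refine ⟨1 / 40000, by norm_num, 500, by norm_num, ?_⟩
  intro ω hω T hT γ hγ hturn hlen he0 t ht
  have hmem0 := ElasticFlow.zero_mem_timeInterval hT
  have hω1 : (1 : ℝ) ≤ ω := by exact_mod_cast hω
  have hlen_t : ∀ s ∈ ElasticFlow.timeInterval T,
      ElasticFlow.length (γ s) = 2 * Real.pi * ω := fun s hs =>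
    (ElasticFlow.eq_initial_of_hasDerivWithinAt_zero
      (f := fun s => ElasticFlow.length (γ s)) hT
      (fun r hr => (hγ.hasDerivWithinAt hT hr).1) hs).trans hlen
  have hk0 : ElasticFlow.arcIntegral (γ 0) (ElasticFlow.curvature (γ 0)) = 2 * Real.pi * ω := by
    rw [← hturn, ElasticFlow.turningNumber, mul_inv_cancel_left₀ (by positivity)]
  have hk_t : ∀ s ∈ ElasticFlow.timeInterval T,
      ElasticFlow.arcIntegral (γ s) (ElasticFlow.curvature (γ s)) = 2 * Real.pi * ω :=
    fun s hs => (ElasticFlow.eq_initial_of_hasDerivWithinAt_zero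
      (f := fun s => ElasticFlow.arcIntegral (γ s) (ElasticFlow.curvature (γ s))) hT
      (fun r hr => (hγ.hasDerivWithinAt hT hr).2.1) hs).trans hk0
  have hL1 : (1 : ℝ) ≤ 2 * Real.pi * ω := by nlinarith [Real.pi_gt_three]
  have hosc : ∀ s ∈ ElasticFlow.timeInterval T,
      ElasticFlow.kOsc (γ s) = 2 * Real.pi * ω * ElasticFlow.curvatureExcess (γ s) :=
    fun s hs => by
      rw [ElasticFlow.kOsc_eq_of_meanCurvature_eq_one, hlen_t s hs]
      rw [ElasticFlow.meanCurvature, hlen_t s hs, hk_t s hs]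
      exact inv_mul_cancel₀ (by positivity)
  have hder := fun s (hs : s ∈ ElasticFlow.timeInterval T) => (hγ.hasDerivWithinAt hT hs).2.2
  have hineq := fun s (hs : s ∈ ElasticFlow.timeInterval T) =>
    (hγ.isClosedImmersion hs).excess_dissipation_le ((hlen_t s hs).symm ▸ hL1)
      ((hk_t s hs).trans (hlen_t s hs).symm)
  have hnonneg : ∀ s, 0 ≤ ElasticFlow.curvatureExcess (γ s) := fun s =>
    ElasticFlow.arcIntegral_nonneg fun u => sq_nonneg _
  have hsub : ∀ s ∈ Set.Icc 0 t, s ∈ ElasticFlow.timeInterval T := fun s hs =>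
    ElasticFlow.mem_timeInterval_of_le ht hs.1 hs.2
  obtain ⟨hle, hdecay⟩ := ElasticFlow.decay_of_small_differential_ineq
    (e := fun s => ElasticFlow.curvatureExcess (γ s)) (C := 500) (ε := 1 / 40000) ht.1
    (by norm_num) (by norm_num) (by norm_num)
    (fun s hs => (hder s (hsub s hs)).continuousWithinAt.mono hsub)
    (fun s hs => (hder s (hsub s ⟨hs.1, hs.2.le⟩)).mono_of_mem_nhdsWithin
      (ElasticFlow.timeInterval_mem_nhdsGE (hsub s ⟨hs.1, hs.2.le⟩)))
    (fun s _ => hnonneg s) (fun s hs => hineq s (hsub s ⟨hs.1, hs.2.le⟩)) he0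
  have hpiω : 0 ≤ 2 * Real.pi * ω := by positivity
  refine ⟨(hder t ht).differentiableWithinAt, ?_, hdecay, ?_, ?_⟩
  · rw [(hder t ht).derivWithin (ElasticFlow.uniqueDiffOn_timeInterval hT t ht)]
    exact hineq t ht (hle.trans he0)
  · rw [hosc t ht, hosc 0 hmem0]
    exact mul_le_mul_of_nonneg_left hle hpiω
  · rw [hosc t ht, hosc 0 hmem0]
    refine (mul_le_mul_of_nonneg_left hdecay hpiω).trans_eq ?_
    ring
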